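/- Let $M^{2n+1}$ be a smooth manifold with a contact pseudo-metric structure $(\varphi,\xi,\eta,g)$: $g$ is a pseudo-Riemannian metric, $\varphi$ a $(1,1)$-tensor field, $\xi$ a vector field, $\eta$ a $1$-form (all smooth), $\varepsilon=\pm1$, and for all vector fields $X,Y$ $$\eta(\xi)=1,\qquad \varphi^2X=-X+\eta(X)\xi,\qquad g(\varphi X,\varphi Y)=g(X,Y)-\varepsilon\eta(X)\eta(Y),\qquad d\eta(X,Y)=g(X,\varphi Y),$$ where $2\,d\eta(X,Y)=X\eta(Y)-Y\eta(X)-\eta([X,Y])$. Let $\nabla$ be the Levi-Civita connection of $g$, $R(X,Y)=[\nabla_X,\nabla_Y]-\nabla_{[X,Y]}$, $h=\tfrac12\mathcal L_\xi\varphi$, let $K(X,Y)=\dfrac{g(R(X,Y)Y,X)}{g(X,X)g(Y,Y)-g(X,Y)^2}$ be the sectional curvature of a nondegenerate plane, $\mathrm{Ric}(X,Y)=\operatorname{tr}(Z\mapsto R(Z,X)Y)$ the Ricci tensor, and $Q$ the Ricci operator, $g(QX,Y)=\mathrm{Ric}(X,Y)$. Suppose that $M$ is a $(\kappa,\mu)$-contact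 pseudo-metric manifold, i.e. for real constants $\kappa,\mu$ and all $X,Y$ $$R(X,Y)\xi=\varepsilon\kappa\,(\eta(Y)X-\eta(X)Y)+\varepsilon\mu\,(\eta(Y)hX-\eta(X)hY),$$ and that $\varepsilon\kappa<1$. Put $\lambda=\sqrt{1-\varepsilon\kappa}$ and let $\mathcal D(\pm\lambda)$ be the eigenspaces of $h$ for the eigenvalues $\pm\lambda$. Then at every point of $M$: (i) for every $X$ orthogonal to $\xi$ with $g(X,X)\ne0$, the $\xi$-sectional curvature is $$K(X,\xi)=\kappa+\mu\frac{g(hX,X)}{g(X,X)},$$ which equals $\kappa+\lambda\mu$ if $X\in\mathcal D(\lambda)$ and $\kappa-\lambda\mu$ if $X\in\mathcal D(-\lambda)$; (ii) $K(X,Y)=2(\varepsilon+\lambda)-\varepsilon\mu$ if $X,Y\in\mathcal D(\lambda)$ span a nondegenerate plane; $K(X,Y)=2(\varepsilon-\lambda)-\varepsilon\mu$ if $X,Y\in\mathcal D(-\lambda)$ span a nondegenerate plane (such planes exist only for $n>1$); and $$K(X,Y)=-(\kappa+\varepsilon\mu)\frac{g(X,\varphi Y)^2}{g(X,X)\,g(Y,Y)}$$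 if $X\in\mathcal D(\lambda)$, $Y\in\mathcal D(-\lambda)$ and $g(X,X)\neq0\neq g(Y,Y)$; (iii) for every tangent vector $X$, $$QX=\varepsilon[2(n-1)-n\mu]X+(2(n-1)+\mu)hX+[2(1-n)\varepsilon+2n\kappa+n\varepsilon\mu]\eta(X)\xi.$$ -/

import Mathlib

open Bundle FiberBundle VectorField
open scoped Manifold ContDiff

set_option linter.unusedSectionVars false

noncomputable section

variable {E : Type*} [NormedAddCommGroup E] [NormedSpace ℝ E] [FiniteDimensional ℝ E]
  [CompleteSpace E] {H : Type*} [TopologicalSpace H] {I : ModelWithCorners ℝ E H}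
  {M : Type*} [TopologicalSpace M] [ChartedSpace H M] [IsManifold I ∞ M]

instance tangentSpace_finiteDimensional (x : M) : FiniteDimensional ℝ (TangentSpace I x) :=
  inferInstanceAs (FiniteDimensional ℝ E)

instance tangentSpace_t2Space (x : M) : T2Space (TangentSpace I x) :=
  inferInstanceAs (T2Space E)

variable (I M) in
/-- A smooth pseudo-Riemannian metric on `M`: a smooth field of nondegenerate symmetric bilinear
forms on the tangent spaces. -/
structure PseudoRiemannianMetric where
  val : ∀ x : M, TangentSpace I x →L[ℝ] TangentSpace I x →L[ℝ] ℝ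
  symm : ∀ (x : M) (u v : TangentSpace I x), val x u v = val x v u
  nondegenerate : ∀ (x : M) (u : TangentSpace I x), (∀ v, val x u v = 0) → u = 0
  contMDiff : ContMDiff I (I.prod 𝓘(ℝ, E →L[ℝ] E →L[ℝ] ℝ)) ∞
    (fun x ↦ TotalSpace.mk' (E →L[ℝ] E →L[ℝ] ℝ) x (val x))

namespace PseudoRiemannianMetric

variable (g : PseudoRiemannianMetric I M)

/-- The bilinear form `g_x`. -/
def bilin (x : M) : LinearMap.BilinForm ℝ (TangentSpace I x) :=
  LinearMap.mk₂ ℝ (fun u v ↦ g.val x u v) (by simp) (by simp) (by simp) (by simp)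

theorem bilin_nondegenerate (x : M) : (g.bilin x).Nondegenerate := by
  refine ⟨fun u hu ↦ g.nondegenerate x u hu, fun u hu ↦ g.nondegenerate x u fun v ↦ ?_⟩
  rw [g.symm]; exact hu v

/-- Raising the index: `g_x (sharp α, v) = α v`. -/
def sharp (x : M) (α : Module.Dual ℝ (TangentSpace I x)) : TangentSpace I x :=
  ((g.bilin x).toDual (g.bilin_nondegenerate x)).symm α

theorem val_sharp (x : M) (α : Module.Dual ℝ (TangentSpace I x)) (v : TangentSpace I x) :
    g.val x (g.sharp x α) v = α v :=
  LinearMap.BilinForm.apply_toDual_symm_apply (hB := g.bilin_nondegenerate x) α v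

theorem mdifferentiableAt_val {Y Z : Π x : M, TangentSpace I x} {x : M}
    (hY : MDiffAt (T% Y) x) (hZ : MDiffAt (T% Z) x) : MDiffAt (fun y ↦ g.val y (Y y) (Z y)) x := by
  have : MDifferentiableAt I (I.prod 𝓘(ℝ)) 
      (fun m ↦ TotalSpace.mk' ℝ (E := Bundle.Trivial M ℝ) m (g.val m (Y m) (Z m))) x := by
    apply MDifferentiableAt.clm_bundle_apply₂ (F₁ := E) (F₂ := E)
    · exact g.contMDiff.mdifferentiableAt (by simp)
    · exact hY
    · exact hZ
  simp only [mdifferentiableAt_totalSpace] at this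
  exact this.2

/-- The right-hand side of the Koszul formula for `g (∇_X Y, Z)`. -/
def koszul (X Y Z : Π x : M, TangentSpace I x) (x : M) : ℝ :=
  (1 / 2) * (d% (fun y ↦ g.val y (Y y) (Z y)) x (X x)
    + d% (fun y ↦ g.val y (Z y) (X y)) x (Y x)
    - d% (fun y ↦ g.val y (X y) (Y y)) x (Z x)
    + g.val x (mlieBracket I X Y x) (Z x)
    - g.val x (mlieBracket I Y Z x) (X x)
    + g.val x (mlieBracket I Z X x) (Y x))

variable {Y : Π x : M, TangentSpace I x} {x : M}

theorem tensorialAt_koszul_left (hY : MDiffAt (T% Y) x) {Z : Π x : M, TangentSpace I x}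
    (hZ : MDiffAt (T% Z) x) : TensorialAt I E (g.koszul · Y Z x) x where
  smul {f X} hf hX := by
    have h1 : d% (fun y ↦ g.val y (Z y) ((f • X) y)) x
        = f x • d% (fun y ↦ g.val y (Z y) (X y)) x + g.val x (Z x) (X x) • d% f x := by
      rw [← mvfderiv_mul hf (g.mdifferentiableAt_val hZ hX)]
      congr 1; ext y; simp
    have h2 : d% (fun y ↦ g.val y ((f • X) y) (Y y)) x
        = f x • d% (fun y ↦ g.val y (X y) (Y y)) x + g.val x (X x) (Y x) • d% f x := by
      rw [← mvfderiv_mul hf (g.mdifferentiableAt_val hX hY)]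
      congr 1; ext y; simp
    simp only [koszul, h1, h2, mlieBracket_smul_left hf hX, mlieBracket_smul_right hf hX]
    simp [g.symm x (Z x) (X x)]
    ring
  add {X X'} hX hX' := by
    have h1 : d% (fun y ↦ g.val y (Z y) ((X + X') y)) x
        = d% (fun y ↦ g.val y (Z y) (X y)) x + d% (fun y ↦ g.val y (Z y) (X' y)) x := by
      rw [← mvfderiv_add (g.mdifferentiableAt_val hZ hX) (g.mdifferentiableAt_val hZ hX')]
      congr 1; ext y; simp
    have h2 : d% (fun y ↦ g.val y ((X + X') y) (Y y)) x
        = d% (fun y ↦ g.val y (X y) (Y y)) x + d% (fun y ↦ g.val y (X' y) (Y y)) x := by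
      rw [← mvfderiv_add (g.mdifferentiableAt_val hX hY) (g.mdifferentiableAt_val hX' hY)]
      congr 1; ext y; simp
    simp only [koszul, h1, h2, mlieBracket_add_left hX hX', mlieBracket_add_right hX hX']
    simp
    ring

theorem tensorialAt_koszul_right (hY : MDiffAt (T% Y) x) {X : Π x : M, TangentSpace I x}
    (hX : MDiffAt (T% X) x) : TensorialAt I E (g.koszul X Y · x) x where
  smul {f Z} hf hZ := by
    have h1 : d% (fun y ↦ g.val y ((f • Z) y) (X y)) x
        = f x • d% (fun y ↦ g.val y (Z y) (X y)) x + g.val x (Z x) (X x) • d% f x := by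
      rw [← mvfderiv_mul hf (g.mdifferentiableAt_val hZ hX)]
      congr 1; ext y; simp
    have h2 : d% (fun y ↦ g.val y (Y y) ((f • Z) y)) x
        = f x • d% (fun y ↦ g.val y (Y y) (Z y)) x + g.val x (Y x) (Z x) • d% f x := by
      rw [← mvfderiv_mul hf (g.mdifferentiableAt_val hY hZ)]
      congr 1; ext y; simp
    simp only [koszul, h1, h2, mlieBracket_smul_left hf hZ, mlieBracket_smul_right hf hZ]
    simp [g.symm x (Y x) (Z x)]
    ring
  add {Z Z'} hZ hZ' := by
    have h1 : d% (fun y ↦ g.val y ((Z + Z') y) (X y)) x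
        = d% (fun y ↦ g.val y (Z y) (X y)) x + d% (fun y ↦ g.val y (Z' y) (X y)) x := by
      rw [← mvfderiv_add (g.mdifferentiableAt_val hZ hX) (g.mdifferentiableAt_val hZ' hX)]
      congr 1; ext y; simp
    have h2 : d% (fun y ↦ g.val y (Y y) ((Z + Z') y)) x
        = d% (fun y ↦ g.val y (Y y) (Z y)) x + d% (fun y ↦ g.val y (Y y) (Z' y)) x := by
      rw [← mvfderiv_add (g.mdifferentiableAt_val hY hZ) (g.mdifferentiableAt_val hY hZ')]
      congr 1; ext y; simp
    simp only [koszul, h1, h2, mlieBracket_add_left hZ hZ', mlieBracket_add_right hZ hZ']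
    simp
    ring

open Classical in
/-- `leviCivitaFun g Y x u` is `∇_u Y`, determined by the Koszul formula (and set to `0` if `Y`
is not differentiable at `x`). -/
def leviCivitaFun (Y : Π x : M, TangentSpace I x) (x : M) :
    TangentSpace I x →L[ℝ] TangentSpace I x :=
  if hY : MDiffAt (T% Y) x then
    LinearMap.toContinuousLinearMap
      (((g.bilin x).toDual (g.bilin_nondegenerate x)).symm.toLinearMap ∘ₗ
        LinearMap.toContinuousLinearMap.symm.toLinearMap ∘ₗ
        (TensorialAt.mkHom₂ (fun X Z ↦ g.koszul X Y Z x) x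
          (fun _ hZ ↦ g.tensorialAt_koszul_left hY hZ)
          (fun _ hX ↦ g.tensorialAt_koszul_right hY hX)).toLinearMap)
  else 0

/-- The Koszul formula. -/
theorem val_leviCivitaFun {X Y Z : Π x : M, TangentSpace I x} {x : M} (hX : MDiffAt (T% X) x)
    (hY : MDiffAt (T% Y) x) (hZ : MDiffAt (T% Z) x) :
    g.val x (g.leviCivitaFun Y x (X x)) (Z x) = g.koszul X Y Z x := by
  rw [leviCivitaFun, dif_pos hY, ← TensorialAt.mkHom₂_apply
    (fun _ hZ ↦ g.tensorialAt_koszul_left hY hZ)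
    (fun _ hX ↦ g.tensorialAt_koszul_right hY hX) hX hZ]
  exact g.val_sharp x _ (Z x)

theorem ext_val {u v : TangentSpace I x} (h : ∀ w, g.val x u w = g.val x v w) : u = v := by
  refine sub_eq_zero.1 (g.nondegenerate x _ fun w ↦ ?_)
  simp [h]


/-- Uniqueness in the Koszul formula, tested on local extensions of tangent vectors. -/
theorem leviCivitaFun_eq {X Y : Π x : M, TangentSpace I x} {x : M} (hX : MDiffAt (T% X) x)
    (hY : MDiffAt (T% Y) x) {w : TangentSpace I x}
    (h : ∀ Z : Π x : M, TangentSpace I x, MDiffAt (T% Z) x →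
      g.koszul X Y Z x = g.val x w (Z x)) : g.leviCivitaFun Y x (X x) = w := by
  refine g.ext_val fun v ↦ ?_
  have hZ := mdifferentiableAt_extend I E v
  have := (g.val_leviCivitaFun hX hY hZ).trans (h _ hZ)
  simpa using this

variable (I) in
theorem ext_clm {A B : TangentSpace I x →L[ℝ] TangentSpace I x}
    (h : ∀ X : Π x : M, TangentSpace I x, MDiffAt (T% X) x → A (X x) = B (X x)) : A = B := by
  ext1 v
  simpa using h _ (mdifferentiableAt_extend I E v)

/-- The Levi-Civita connection of `g`; `g.leviCivita Y x u` is `∇_u Y`. -/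
def leviCivita : CovariantDerivative I E (TangentSpace I : M → Type _) where
  toFun := g.leviCivitaFun
  isCovariantDerivativeOnUniv :=
    { add := by
        intro Y Y' x hY hY' _
        refine ext_clm I fun X hX ↦ ?_
        refine g.leviCivitaFun_eq hX (mdifferentiableAt_add_section hY hY') fun Z hZ ↦ ?_
        have h1 : d% (fun y ↦ g.val y ((Y + Y') y) (Z y)) x
            = d% (fun y ↦ g.val y (Y y) (Z y)) x + d% (fun y ↦ g.val y (Y' y) (Z y)) x := by
          rw [← mvfderiv_add (g.mdifferentiableAt_val hY hZ) (g.mdifferentiableAt_val hY' hZ)]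
          congr 1; ext y; simp
        have h2 : d% (fun y ↦ g.val y (X y) ((Y + Y') y)) x
            = d% (fun y ↦ g.val y (X y) (Y y)) x + d% (fun y ↦ g.val y (X y) (Y' y)) x := by
          rw [← mvfderiv_add (g.mdifferentiableAt_val hX hY) (g.mdifferentiableAt_val hX hY')]
          congr 1; ext y; simp
        simp only [add_apply, map_add, g.val_leviCivitaFun hX hY hZ,
          g.val_leviCivitaFun hX hY' hZ]
        simp only [koszul, h1, h2, mlieBracket_add_left hY hY', mlieBracket_add_right hY hY']
        simp
        ring
      leibniz := by
        intro Y f x hY hf _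
        refine ext_clm I fun X hX ↦ ?_
        refine g.leviCivitaFun_eq hX (hf.smul_section hY) fun Z hZ ↦ ?_
        have h1 : d% (fun y ↦ g.val y ((f • Y) y) (Z y)) x
            = f x • d% (fun y ↦ g.val y (Y y) (Z y)) x + g.val x (Y x) (Z x) • d% f x := by
          rw [← mvfderiv_mul hf (g.mdifferentiableAt_val hY hZ)]
          congr 1; ext y; simp
        have h2 : d% (fun y ↦ g.val y (X y) ((f • Y) y)) x
            = f x • d% (fun y ↦ g.val y (X y) (Y y)) x + g.val x (X x) (Y x) • d% f x := by
          rw [← mvfderiv_mul hf (g.mdifferentiableAt_val hX hY)]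
          congr 1; ext y; simp
        simp only [add_apply, smul_apply, map_add,
          map_smul, g.val_leviCivitaFun hX hY hZ]
        simp only [koszul, h1, h2, mlieBracket_smul_left hf hY, mlieBracket_smul_right hf hY]
        simp [g.symm x (Y x) (X x)]
        ring }

/-- The Levi-Civita connection is torsion-free. -/
theorem torsion_leviCivita : g.leviCivita.torsion = 0 := by
  rw [CovariantDerivative.torsion_eq_zero_iff]
  intro X Y x hX hY
  refine g.ext_val fun v ↦ ?_
  have hZ := mdifferentiableAt_extend I E v
  have h1 := g.val_leviCivitaFun hX hY hZ
  have h2 := g.val_leviCivitaFun hY hX hZ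
  change g.val x (g.leviCivitaFun Y x (X x) - g.leviCivitaFun X x (Y x)) v = _
  rw [extend_apply_self] at h1 h2
  simp only [map_sub, sub_apply, h1, h2]
  have hs (A B : Π x : M, TangentSpace I x) :
      (fun y ↦ g.val y (A y) (B y)) = fun y ↦ g.val y (B y) (A y) := by
    ext y; exact g.symm y _ _
  simp only [koszul, hs (extend E v) X, hs (extend E v) Y, hs Y X,
    mlieBracket_swap_apply (V := extend E v), mlieBracket_swap_apply (V := Y) (W := X)]
  simp
  ring

/-- The Levi-Civita connection is compatible with `g`. -/
theorem leviCivita_metric {X Y Z : Π x : M, TangentSpace I x} {x : M} (hX : MDiffAt (T% X) x)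
    (hY : MDiffAt (T% Y) x) (hZ : MDiffAt (T% Z) x) :
    d% (fun y ↦ g.val y (Y y) (Z y)) x (X x)
      = g.val x (g.leviCivita Y x (X x)) (Z x) + g.val x (Y x) (g.leviCivita Z x (X x)) := by
  rw [g.symm x (Y x)]
  change _ = g.val x (g.leviCivitaFun Y x (X x)) (Z x) + g.val x (g.leviCivitaFun Z x (X x)) (Y x)
  rw [g.val_leviCivitaFun hX hY hZ, g.val_leviCivitaFun hX hZ hY]
  have hs (A B : Π x : M, TangentSpace I x) :
      (fun y ↦ g.val y (A y) (B y)) = fun y ↦ g.val y (B y) (A y) := by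
    ext y; exact g.symm y _ _
  simp only [koszul, hs Z Y, hs X Z, hs Y X, mlieBracket_swap_apply (V := Z) (W := Y),
    mlieBracket_swap_apply (V := Y) (W := X), mlieBracket_swap_apply (V := Z) (W := X)]
  simp
  ring

/-- `R(X, Y)Z = ∇_X ∇_Y Z - ∇_Y ∇_X Z - ∇_[X, Y] Z` for vector fields. -/
def curvatureField (X Y Z : Π x : M, TangentSpace I x) (x : M) : TangentSpace I x :=
  g.leviCivita (fun y ↦ g.leviCivita Z y (Y y)) x (X x)
    - g.leviCivita (fun y ↦ g.leviCivita Z y (X y)) x (Y x)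
    - g.leviCivita Z x (mlieBracket I X Y x)

/-- The curvature tensor `R(u, v)w` at `x`, computed with any local smooth extensions of the
tangent vectors `u, v, w`. -/
def curvature (x : M) (u v w : TangentSpace I x) : TangentSpace I x :=
  g.curvatureField (extend E u) (extend E v) (extend E w) x

/-- The `(0,4)`-curvature tensor `R(u, v, w, z) = g(R(w, z)v, u)`. -/
def curvature₄ (x : M) (u v w z : TangentSpace I x) : ℝ :=
  g.val x (g.curvature x w z v) u

/-- The pair `u, v` spans a nondegenerate plane. -/
def IsNondegeneratePlane (x : M) (u v : TangentSpace I x) : Prop :=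
  g.val x u u * g.val x v v - g.val x u v ^ 2 ≠ 0

/-- The sectional curvature of the plane spanned by `u, v`
(meaningful if that plane is nondegenerate). -/
def sectionalCurvature (x : M) (u v : TangentSpace I x) : ℝ :=
  g.curvature₄ x u v u v / (g.val x u u * g.val x v v - g.val x u v ^ 2)

/-- The Ricci tensor `Ric(u, v)`: the trace of `w ↦ R(w, u)v`. -/
def ricci (x : M) (u v : TangentSpace I x) : ℝ :=
  ∑ i, (Module.finBasis ℝ (TangentSpace I x)).coord i
    (g.curvature x (Module.finBasis ℝ (TangentSpace I x) i) u v)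

/-- The Ricci operator `Q`, with `g(Qu, v) = Ric(u, v)` (imposed for `v` in a basis). -/
def ricciOperator (x : M) (u : TangentSpace I x) : TangentSpace I x :=
  g.sharp x ((Module.finBasis ℝ (TangentSpace I x)).constr ℝ
    fun i ↦ g.ricci x u (Module.finBasis ℝ (TangentSpace I x) i))

end PseudoRiemannianMetric

/-- The exterior derivative of a 1-form, with the normalization
`2 dη(X, Y) = X(η Y) - Y(η X) - η[X, Y]`. -/
def extDerivOneForm (η : Π x : M, TangentSpace I x →L[ℝ] ℝ) (x : M) (u v : TangentSpace I x) : ℝ :=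
  (1 / 2) * (d% (fun y ↦ η y (extend E v y)) x u - d% (fun y ↦ η y (extend E u y)) x v
    - η x (mlieBracket I (extend E u) (extend E v) x))

/-- The Lie derivative `(L_ξ φ)X = [ξ, φX] - φ[ξ, X]` of a `(1,1)`-tensor field. -/
def lieDerivEndo (ξ : Π x : M, TangentSpace I x)
    (φ : Π x : M, TangentSpace I x →L[ℝ] TangentSpace I x) (x : M) (u : TangentSpace I x) :
    TangentSpace I x :=
  mlieBracket I ξ (fun y ↦ φ y (extend E u y)) x - φ x (mlieBracket I ξ (extend E u) x)

variable (I M) in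
/-- A contact pseudo-metric structure `(φ, ξ, η, g)` with `g(ξ, ξ) = ε = ±1`. -/
structure ContactPseudoMetricStructure where
  g : PseudoRiemannianMetric I M
  φ : ∀ x : M, TangentSpace I x →L[ℝ] TangentSpace I x
  ξ : ∀ x : M, TangentSpace I x
  η : ∀ x : M, TangentSpace I x →L[ℝ] ℝ
  ε : ℝ
  contMDiff_φ : ContMDiff I (I.prod 𝓘(ℝ, E →L[ℝ] E)) ∞
    (fun x ↦ TotalSpace.mk' (E →L[ℝ] E) (E := fun x ↦ TangentSpace I x →L[ℝ] TangentSpace I x)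
      x (φ x))
  contMDiff_ξ : ContMDiff I (I.prod 𝓘(ℝ, E)) ∞ (fun x ↦ TotalSpace.mk' E x (ξ x))
  contMDiff_η : ContMDiff I (I.prod 𝓘(ℝ, E →L[ℝ] ℝ)) ∞
    (fun x ↦ TotalSpace.mk' (E →L[ℝ] ℝ) (E := fun x ↦ TangentSpace I x →L[ℝ] ℝ) x (η x))
  ε_eq : ε = 1 ∨ ε = -1
  η_ξ : ∀ x, η x (ξ x) = 1
  φ_φ : ∀ (x : M) (u : TangentSpace I x), φ x (φ x u) = -u + η x u • ξ x
  g_φ_φ : ∀ (x : M) (u v : TangentSpace I x),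
    g.val x (φ x u) (φ x v) = g.val x u v - ε * η x u * η x v
  dη_eq : ∀ (x : M) (u v : TangentSpace I x), extDerivOneForm η x u v = g.val x u (φ x v)

namespace ContactPseudoMetricStructure

variable (S : ContactPseudoMetricStructure I M)

/-- The tensor field `h = (1/2) L_ξ φ`. -/
def h (x : M) (u : TangentSpace I x) : TangentSpace I x :=
  (1 / 2 : ℝ) • lieDerivEndo S.ξ S.φ x u

/-- The eigenspace of `h` at `x` for the eigenvalue `c`. -/
def D (c : ℝ) (x : M) : Set (TangentSpace I x) := {u | S.h x u = c • u}

/-- `M` is a `(κ, μ)`-contact pseudo-metric manifold: `ξ` lies in the `(κ, μ)`-nullity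
distribution. -/
def IsKappaMu (κ μ : ℝ) : Prop :=
  ∀ (x : M) (u v : TangentSpace I x),
    S.g.curvature x u v (S.ξ x) =
      (S.ε * κ) • (S.η x v • u - S.η x u • v) + (S.ε * μ) • (S.η x v • S.h x u - S.η x u • S.h x v)

end ContactPseudoMetricStructure

end

/-! Everything rests on finding ∇φ and ∇(φh) explicitly. Because ∇_X ξ = -εφX - φhX, the nullity
condition on R(X,Y)ξ is a condition on the alternations of these two tensors.

Putting X = ξ and separating the terms by their behaviour under conjugation with φ gives h² =
(εκ-1)φ² (`IsKappaMu.W_W`). On ker η this is the positive scalar 1 - εκ, so h is diagonalisable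
there with eigenvalues ±λ although g may be indefinite, and φ exchanges the two eigenspaces. For
horizontal X, Y the condition reads R(X,Y)ξ = 0. Combined with dΦ = 0 for Φ = g(·,φ·) and with hφ +
φh = 0, it yields g((∇_{hX}φ)Y,Z) = 0 (`g_T_h`). Since h is invertible on ker η, the horizontal part
of ∇φ vanishes. Then g((∇_X φh)Y,Z) is totally symmetric on ker η, while differentiating (φh)² =
(εκ-1)φ² allows φh to pass from one slot to another at the cost of a sign; going round three slots
shows that it vanishes too (`g_V_eq_zero`). Only ξ-components remain, and they are known.

The Ricci identity now gives the commutators of R(X,Y) with φ and with φh on ker η. For Z, U in the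
same eigenspace, these are essentially the sum and the difference of g(R(X,Y)φZ,U) and
g(R(X,Y)Z,φU), so both components are determined (`g_R_φ_of_eigen`). Components with all four
entries in one eigenspace follow from the φ-commutator, pair symmetry and the Bianchi identity
(`g_R_same`). The sectional curvatures are read off, and the Ricci tensor is the trace over ξ and
the two eigenspaces.

The differentiations take place in an algebraic model: a module of vector fields over a ring of
functions, with a metric connection whose alternation ∇_X Y - ∇_Y X serves as the bracket, so that
tensors are simply linear maps over the ring. Smooth fields on a trivializing open set form such a
model, and evaluation at a point gives a purely linear-algebraic object in which the last part of
the computation is done. -/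

/-! ### Connections and curvature over a commutative ring of functions. -/

/-- An algebraic model of the module `𝔛` of vector fields over the ring `A` of functions, with the
Levi-Civita connection `nab` of a metric `g`. -/
structure MetricCalculus (A 𝔛 : Type*) [CommRing A] [Algebra ℝ A] [AddCommGroup 𝔛]
    [Module A 𝔛] where
  D : 𝔛 →ₗ[A] Derivation ℝ A A
  nab : 𝔛 →ₗ[A] 𝔛 →+ 𝔛
  g : 𝔛 →ₗ[A] 𝔛 →ₗ[A] A
  nab_smul : ∀ (X : 𝔛) (f : A) (Y : 𝔛), nab X (f • Y) = f • nab X Y + D X f • Y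
  jacobi : ∀ X Y Z : 𝔛,
    nab X (nab Y Z - nab Z Y) - nab (nab Y Z - nab Z Y) X =
      (nab (nab X Y - nab Y X) Z - nab Z (nab X Y - nab Y X)) +
      (nab Y (nab X Z - nab Z X) - nab (nab X Z - nab Z X) Y)
  g_symm : ∀ X Y, g X Y = g Y X
  g_nondeg : ∀ X, (∀ Y, g X Y = 0) → X = 0
  metric : ∀ X Y Z, D X (g Y Z) = g (nab X Y) Z + g Y (nab X Z)
  faithful : ∀ a : A, (∀ X : 𝔛, a • X = 0) → a = 0

namespace MetricCalculus

variable {A 𝔛 : Type*} [CommRing A] [Algebra ℝ A] [AddCommGroup 𝔛] [Module A 𝔛]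

theorem two_mul_cancel {a b : A} (h : 2 * a = 2 * b) : a = b := by
  have h2 : algebraMap ℝ A (1 / 2) * 2 = 1 := by
    rw [← map_ofNat (algebraMap ℝ A) 2, ← map_mul]; norm_num
  linear_combination (algebraMap ℝ A (1 / 2)) * h + (b - a) * h2

theorem two_smul_cancel {X Y : 𝔛} (h : (2 : A) • X = (2 : A) • Y) : X = Y := by
  have h2 : algebraMap ℝ A (1 / 2) * 2 = 1 := by
    rw [← map_ofNat (algebraMap ℝ A) 2, ← map_mul]; norm_num
  have h3 := congrArg (algebraMap ℝ A (1 / 2) • ·) h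
  simpa only [smul_smul, h2, one_smul] using h3

variable (C : MetricCalculus A 𝔛)

/-- The Lie bracket. -/
def br (X Y : 𝔛) : 𝔛 := C.nab X Y - C.nab Y X

theorem ext_g {X Y : 𝔛} (h : ∀ Z, C.g X Z = C.g Y Z) : X = Y :=
  sub_eq_zero.1 (C.g_nondeg _ fun Z ↦ by simp [h])

/-- The Jacobi identity for X, Y, fZ minus f times the one for X, Y, Z leaves the difference of the
two sides multiplied by Z. As Z is arbitrary, faithfulness of the module finishes, so this
compatibility need not be an axiom. -/
theorem flat (X Y : 𝔛) (f : A) :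
    C.D (C.br X Y) f = C.D X (C.D Y f) - C.D Y (C.D X f) := by
  refine sub_eq_zero.1 (C.faithful _ fun Z ↦ ?_)
  have h1 := C.jacobi X Y (f • Z)
  have h2 := C.jacobi X Y Z
  simp only [br, map_sub, map_add, map_smul, C.nab_smul, AddMonoidHom.sub_apply,
    AddMonoidHom.add_apply, AddMonoidHom.smul_apply, Derivation.sub_apply] at h1 h2 ⊢
  linear_combination (norm := module) f • h2 - h1

/-- The curvature operator. -/
def R : 𝔛 →ₗ[A] 𝔛 →ₗ[A] 𝔛 →ₗ[A] 𝔛 :=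
  LinearMap.mk₂ A (fun X Y ↦
    { toFun := fun Z ↦ C.nab X (C.nab Y Z) - C.nab Y (C.nab X Z) - C.nab (C.br X Y) Z
      map_add' := fun Z Z' ↦ by simp only [map_add]; abel
      map_smul' := fun f Z ↦ by
        simp only [C.nab_smul, map_add, RingHom.id_apply, C.flat]; module })
    (fun X X' Y ↦ by
      ext Z
      simp only [br, LinearMap.coe_mk, AddHom.coe_mk, LinearMap.add_apply, map_add, map_sub,
        AddMonoidHom.add_apply, AddMonoidHom.sub_apply]
      abel)
    (fun f X Y ↦ by
      ext Z
      simp only [br, LinearMap.coe_mk, AddHom.coe_mk, LinearMap.smul_apply, map_smul, map_sub,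
        AddMonoidHom.smul_apply, AddMonoidHom.sub_apply, C.nab_smul, map_add,
        AddMonoidHom.add_apply]
      module)
    (fun X Y Y' ↦ by
      ext Z
      simp only [br, LinearMap.coe_mk, AddHom.coe_mk, LinearMap.add_apply, map_add, map_sub,
        AddMonoidHom.add_apply, AddMonoidHom.sub_apply]
      abel)
    (fun f X Y ↦ by
      ext Z
      simp only [br, LinearMap.coe_mk, AddHom.coe_mk, LinearMap.smul_apply, map_smul, map_sub,
        AddMonoidHom.smul_apply, AddMonoidHom.sub_apply, C.nab_smul, map_add,
        AddMonoidHom.add_apply]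
      module)

theorem R_eq (X Y Z : 𝔛) :
    C.R X Y Z = C.nab X (C.nab Y Z) - C.nab Y (C.nab X Z) - C.nab (C.br X Y) Z := rfl

theorem R_swap (X Y Z : 𝔛) : C.R X Y Z = -C.R Y X Z := by
  simp only [R_eq, br, map_sub, AddMonoidHom.sub_apply]; abel

theorem bianchi (X Y Z : 𝔛) : C.R X Y Z + C.R Y Z X + C.R Z X Y = 0 := by
  have h := C.jacobi X Y Z
  simp only [R_eq, br, map_sub, AddMonoidHom.sub_apply] at h ⊢
  linear_combination (norm := module) h

/-- By `flat`, the operator D_X D_Y - D_Y D_X - D_[X,Y] kills the function g(Z,W); metric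
compatibility expands it into the two curvature terms. -/
theorem g_R_skew (X Y Z W : 𝔛) : C.g (C.R X Y Z) W = -C.g Z (C.R X Y W) := by
  have h := C.flat X Y (C.g Z W)
  simp only [C.metric, map_add, R_eq, map_sub, LinearMap.sub_apply] at h ⊢
  linear_combination -h

/-- The usual octahedron argument: a signed sum of four Bianchi identities, in which the skew
symmetries inside each pair cancel all but twice the claim. -/
theorem g_R_pair (X Y Z W : 𝔛) : C.g (C.R X Y Z) W = C.g (C.R Z W X) Y := by
  have b (X Y Z W : 𝔛) : C.g (C.R X Y Z) W + C.g (C.R Y Z X) W + C.g (C.R Z X Y) W = 0 := by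
    rw [← LinearMap.add_apply, ← LinearMap.add_apply, ← map_add, ← map_add, bianchi]; simp
  have s (X Y Z W : 𝔛) : C.g (C.R X Y Z) W = -C.g (C.R Y X Z) W := by rw [R_swap]; simp
  have k (X Y Z W : 𝔛) : C.g (C.R X Y Z) W = -C.g (C.R X Y W) Z := by rw [g_R_skew, g_symm]
  refine two_mul_cancel ?_
  linear_combination b X Y Z W + b Y Z W X - b Z W X Y - b W X Y Z - k Y Z W X - k Z W Y X +
    k W X Y Z + k X Y W Z + k X Z W Y - s X Z Y W + k Y W X Z - s Y W Z X

/-- The covariant derivative of a field of endomorphisms: `covEnd F X Y = (∇_X F) Y`. -/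
def covEnd (F : 𝔛 →ₗ[A] 𝔛) : 𝔛 →ₗ[A] 𝔛 →ₗ[A] 𝔛 :=
  LinearMap.mk₂ A (fun X Y ↦ C.nab X (F Y) - F (C.nab X Y))
    (fun X X' Y ↦ by simp only [map_add, AddMonoidHom.add_apply]; abel)
    (fun f X Y ↦ by simp only [map_smul, AddMonoidHom.smul_apply]; module)
    (fun X Y Y' ↦ by simp only [map_add]; abel)
    (fun f X Y ↦ by simp only [map_smul, C.nab_smul, map_add]; module)

theorem covEnd_apply (F : 𝔛 →ₗ[A] 𝔛) (X Y : 𝔛) :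
    C.covEnd F X Y = C.nab X (F Y) - F (C.nab X Y) := rfl

/-- The commutator of the curvature operator with an endomorphism field. -/
theorem R_comm (F : 𝔛 →ₗ[A] 𝔛) (X Y Z : 𝔛) :
    C.R X Y (F Z) - F (C.R X Y Z) =
      (C.nab X (C.covEnd F Y Z) - C.covEnd F Y (C.nab X Z)) -
      (C.nab Y (C.covEnd F X Z) - C.covEnd F X (C.nab Y Z)) -
      C.covEnd F (C.br X Y) Z := by
  simp only [covEnd_apply, R_eq, map_sub]; abel

theorem g_covEnd_of_symm {F : 𝔛 →ₗ[A] 𝔛} (hF : ∀ X Y, C.g (F X) Y = C.g X (F Y)) (X Y Z : 𝔛) :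
    C.g (C.covEnd F X Y) Z = C.g Y (C.covEnd F X Z) := by
  have h := congrArg (C.D X) (hF Y Z)
  simp only [C.metric, covEnd_apply, map_sub, LinearMap.sub_apply] at h ⊢
  linear_combination h - hF (C.nab X Y) Z - hF Y (C.nab X Z)

theorem g_covEnd_of_skew {F : 𝔛 →ₗ[A] 𝔛} (hF : ∀ X Y, C.g (F X) Y = -C.g X (F Y)) (X Y Z : 𝔛) :
    C.g (C.covEnd F X Y) Z = -C.g Y (C.covEnd F X Z) := by
  have h := congrArg (C.D X) (hF Y Z)
  simp only [map_neg, C.metric, covEnd_apply, map_sub, LinearMap.sub_apply] at h ⊢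
  linear_combination h - hF (C.nab X Y) Z - hF Y (C.nab X Z)

end MetricCalculus

/-! ### Contact pseudo-metric structures: ∇ξ, closedness of Φ, and ∇_ξ φ = 0. -/

/-- The algebraic model of a contact pseudo-metric structure. -/
structure ContactCalculus (A 𝔛 : Type*) [CommRing A] [Algebra ℝ A] [AddCommGroup 𝔛]
    [Module A 𝔛] extends MetricCalculus A 𝔛 where
  φ : 𝔛 →ₗ[A] 𝔛
  ξ : 𝔛
  η : 𝔛 →ₗ[A] A
  ε : A
  D_ε : ∀ X, D X ε = 0
  ε_sq : ε * ε = 1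
  η_ξ : η ξ = 1
  φ_φ : ∀ X, φ (φ X) = -X + η X • ξ
  φ_ξ : φ ξ = 0
  η_φ : ∀ X, η (φ X) = 0
  g_ξ : ∀ X, g X ξ = ε * η X
  g_φ : ∀ X Y, g (φ X) Y = -g X (φ Y)
  dη : ∀ X Y, g Y (nab X ξ) - g X (nab Y ξ) = 2 * ε * g X (φ Y)

namespace ContactCalculus

open MetricCalculus

variable {A 𝔛 : Type*} [CommRing A] [Algebra ℝ A] [AddCommGroup 𝔛] [Module A 𝔛]
  (C : ContactCalculus A 𝔛)

/-- The endomorphism field `X ↦ ∇_X ξ`. -/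
def S : 𝔛 →ₗ[A] 𝔛 where
  toFun X := C.nab X C.ξ
  map_add' X Y := by simp
  map_smul' f X := by simp

theorem S_apply (X : 𝔛) : C.S X = C.nab X C.ξ := rfl

theorem η_eq (X : 𝔛) : C.η X = C.ε * C.g X C.ξ := by
  rw [g_ξ, ← mul_assoc, ε_sq, one_mul]

theorem g_ξ_left (X : 𝔛) : C.g C.ξ X = C.ε * C.η X := by rw [g_symm, g_ξ]

theorem g_S_ξ (X : 𝔛) : C.g (C.S X) C.ξ = 0 := by
  have h := C.metric X C.ξ C.ξ
  rw [g_ξ, η_ξ, mul_one, D_ε, C.g_symm C.ξ] at h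
  refine two_mul_cancel ?_
  rw [S_apply]
  linear_combination -h

theorem η_S (X : 𝔛) : C.η (C.S X) = 0 := by rw [η_eq, g_S_ξ, mul_zero]

/-- The Reeb field is geodesic: ξ lies in the kernel of dη, and ∇ξ takes values orthogonal to ξ
because g(ξ,ξ) = ε is constant. -/
theorem S_ξ : C.S C.ξ = 0 := by
  refine C.g_nondeg _ fun Y ↦ ?_
  have h := C.dη C.ξ Y
  have h2 := C.g_S_ξ Y
  rw [← S_apply, ← S_apply, C.g_symm Y, C.g_symm C.ξ (C.S Y), g_ξ_left, η_φ] at h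
  linear_combination h + h2

theorem D_η (X Y : 𝔛) : C.D X (C.η Y) = C.η (C.nab X Y) + C.ε * C.g (C.S X) Y := by
  have h := C.metric X Y C.ξ
  rw [C.η_eq, Derivation.leibniz, D_ε, smul_zero, add_zero, h, C.η_eq, C.g_symm Y, ← S_apply]
  simp only [smul_eq_mul]; ring

theorem η_nab (X Y : 𝔛) : C.η (C.nab X Y) = C.D X (C.η Y) - C.ε * C.g (C.S X) Y := by
  rw [D_η]; ring

theorem g_S_sub (X Y : 𝔛) : C.g (C.S X) Y - C.g X (C.S Y) = 2 * C.ε * C.g X (C.φ Y) := by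
  rw [← C.dη, C.g_symm (C.S X)]; rfl

/-- For horizontal X, Y this gives η([X,Y]) = -2g(X,φY), the source of the μ-term in the commutator
of the curvature with φh. -/
theorem D_η_alt (X Y : 𝔛) :
    C.D X (C.η Y) - C.D Y (C.η X) - C.η (C.br X Y) = 2 * C.g X (C.φ Y) := by
  have h := C.g_S_sub X Y
  rw [D_η, D_η, br, map_sub, C.g_symm (C.S Y)]
  linear_combination C.ε * h + 2 * C.g X (C.φ Y) * C.ε_sq

/-- The covariant derivative of `φ`. -/
abbrev T : 𝔛 →ₗ[A] 𝔛 →ₗ[A] 𝔛 := C.covEnd C.φ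

theorem g_T_skew (X Y Z : 𝔛) : C.g (C.T X Y) Z = -C.g Y (C.T X Z) :=
  C.g_covEnd_of_skew C.g_φ X Y Z

theorem T_ξ_right (X : 𝔛) : C.T X C.ξ = -C.φ (C.S X) := by
  simp [covEnd_apply, φ_ξ, S_apply]

theorem R_ξ (X Y : 𝔛) : C.R X Y C.ξ = C.covEnd C.S X Y - C.covEnd C.S Y X := by
  simp only [R_eq, covEnd_apply, S_apply, br, map_sub, AddMonoidHom.sub_apply]; abel

/-- The fundamental two-form is closed. -/
theorem g_T_cyclic (X Y Z : 𝔛) :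
    C.g (C.T X Y) Z + C.g (C.T Y Z) X + C.g (C.T Z X) Y = 0 := by
  -- The skew part of S = ∇ξ is a constant multiple of φ by `g_S_sub`; differentiating, the skew
  -- part of ∇S is the same multiple of ∇φ.
  have h (X Y Z : 𝔛) : C.g (C.covEnd C.S X Y) Z - C.g Y (C.covEnd C.S X Z) =
      2 * C.ε * C.g Y (C.T X Z) := by
    have h1 := congrArg (C.D X) (C.g_S_sub Y Z)
    have h2 := C.g_S_sub (C.nab X Y) Z
    have h3 := C.g_S_sub Y (C.nab X Z)
    have h4 : C.D X (2 : A) = 0 := by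
      rw [← map_ofNat (algebraMap ℝ A) 2]; exact (C.D X).map_algebraMap _
    simp only [metric, map_sub, Derivation.leibniz, D_ε, h4, covEnd_apply, LinearMap.sub_apply,
      smul_eq_mul] at h1 ⊢
    linear_combination h1 - h2 - h3
  -- The Bianchi identity paired with ξ. Since R(X,Y)ξ is the alternation of ∇S, it says that the
  -- cyclic sum of the skew part of ∇S is zero.
  have b : C.g (C.R X Y C.ξ) Z + C.g (C.R Y Z C.ξ) X + C.g (C.R Z X C.ξ) Y = 0 := by
    have b := congrArg (C.g C.ξ) (C.bianchi X Y Z)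
    simp only [g_R_skew, map_add, map_zero] at b ⊢
    linear_combination -b
  simp only [R_ξ, map_sub, LinearMap.sub_apply] at b
  have e : 2 * C.ε * (C.g (C.T X Y) Z + C.g (C.T Y Z) X + C.g (C.T Z X) Y) = 0 := by
    rw [C.g_symm (C.T X Y), C.g_symm (C.T Y Z), C.g_symm (C.T Z X)]
    linear_combination -h X Z Y - h Y X Z - h Z Y X - b + C.g_symm (C.covEnd C.S X Y) Z
      + C.g_symm (C.covEnd C.S Y Z) X + C.g_symm (C.covEnd C.S Z X) Y
  refine two_mul_cancel ?_
  linear_combination C.ε * e - 2 * (C.g (C.T X Y) Z + C.g (C.T Y Z) X + C.g (C.T Z X) Y) * C.ε_sq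

theorem φ_φ_φ (X : 𝔛) : C.φ (C.φ (C.φ X)) = -C.φ X := by simp [φ_φ, φ_ξ]

theorem φ_φ_S (X : 𝔛) : C.φ (C.φ (C.S X)) = -C.S X := by simp [φ_φ, η_S]

theorem S_φ_φ (X : 𝔛) : C.S (C.φ (C.φ X)) = -C.S X := by simp [φ_φ, S_ξ]

/-- The covariant derivative of φ² = -1 + η ⊗ ξ. -/
theorem T_φ (X Y : 𝔛) : C.T X (C.φ Y) + C.φ (C.T X Y) =
    (C.ε * C.g (C.S X) Y) • C.ξ + C.η Y • C.S X := by
  simp only [covEnd_apply, φ_φ, map_sub, map_add, map_neg, nab_smul, D_η, S_apply]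
  module

/-- Closedness of Φ with ξ in one slot: the two other terms contain (∇φ)ξ = -φS and so involve only
S. -/
theorem g_T_ξ_left (X Y : 𝔛) :
    C.g (C.T C.ξ X) Y =
      -C.g (C.S (C.φ X)) Y - 2 * C.ε * C.g (C.φ (C.φ X)) Y - C.g (C.φ (C.S X)) Y := by
  have h1 := C.g_T_cyclic C.ξ X Y
  have h2 := C.g_T_skew X Y C.ξ
  have h3 := C.g_S_sub (C.φ X) Y
  rw [T_ξ_right, map_neg, C.g_symm Y] at h2
  rw [T_ξ_right, map_neg, LinearMap.neg_apply, C.g_φ (C.S Y), C.g_symm (C.S Y)] at h1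
  have h4 := C.g_φ (C.φ X) Y
  linear_combination h1 - h2 + h3 + 2 * C.ε * h4

/-- Closedness expresses ∇_ξ φ through S and φ, and the derivative of φ² along ξ says that ∇_ξ φ
anticommutes with φ, since Sξ = 0. Together they give φSφ = S + 2εφ; one more application of φ makes
the expression for ∇_ξ φ vanish. -/
theorem T_ξ_left (X : 𝔛) : C.T C.ξ X = 0 := by
  have h (X : 𝔛) : C.T C.ξ X = -C.S (C.φ X) - (2 * C.ε) • C.φ (C.φ X) - C.φ (C.S X) :=
    C.ext_g fun Y ↦ by simp [g_T_ξ_left]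
  have h1 := C.T_φ C.ξ X
  have h2 : C.φ (C.S (C.φ X)) = C.S X + (2 * C.ε) • C.φ X := by
    refine two_smul_cancel (A := A) ?_
    rw [h, h] at h1
    simp only [S_ξ, map_sub, map_neg, map_smul, φ_φ_φ, φ_φ_S, S_φ_φ, map_zero, LinearMap.zero_apply,
      mul_zero, zero_smul, smul_zero] at h1
    linear_combination (norm := module) -h1
  have h3 := congrArg C.φ h2
  rw [φ_φ, η_S, map_add, map_smul] at h3
  rw [h]
  linear_combination (norm := module) h3

end ContactCalculus

/-! ### The operators h and φh, and h² from the nullity condition. -/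

namespace ContactCalculus

open MetricCalculus

variable {A 𝔛 : Type*} [CommRing A] [Algebra ℝ A] [AddCommGroup 𝔛] [Module A 𝔛]
  (C : ContactCalculus A 𝔛)

/-- The tensor field `h = (1/2) L_ξ φ`, expressed through the connection. -/
def h : 𝔛 →ₗ[A] 𝔛 := C.φ ∘ₗ C.S + C.ε • (C.φ ∘ₗ C.φ)

theorem h_apply (X : 𝔛) : C.h X = C.φ (C.S X) + C.ε • C.φ (C.φ X) := rfl

/-- Identifies the connection formula for h with the Lie derivative. As ∇_ξ φ = 0, one has L_ξ φ =
φS - Sφ, and φS + Sφ = -2εφ² turns this into 2φS + 2εφ². -/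
theorem two_h (X : 𝔛) : C.br C.ξ (C.φ X) - C.φ (C.br C.ξ X) = (2 : A) • C.h X := by
  have h1 := C.T_ξ_left X
  have h2 := C.T_ξ_left (C.φ X)
  have h3 : C.φ (C.S X) + C.S (C.φ X) = -(2 * C.ε) • C.φ (C.φ X) := by
    refine C.ext_g fun Y ↦ ?_
    have h4 := C.g_T_ξ_left X Y
    rw [h1] at h4
    simp only [map_zero, LinearMap.zero_apply, map_add, map_smul, LinearMap.add_apply,
      LinearMap.smul_apply, smul_eq_mul, neg_smul, map_neg, LinearMap.neg_apply] at h4 ⊢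
    linear_combination h4
  rw [covEnd_apply] at h1
  simp only [br, map_sub, h_apply, ← S_apply]
  linear_combination (norm := module) h1 - h3

/-- The endomorphism field `φ h`. -/
def W : 𝔛 →ₗ[A] 𝔛 := C.φ ∘ₗ C.h

theorem W_apply (X : 𝔛) : C.W X = C.φ (C.h X) := rfl

theorem h_ξ : C.h C.ξ = 0 := by simp [h_apply, S_ξ, φ_ξ]

theorem η_h (X : 𝔛) : C.η (C.h X) = 0 := by simp [h_apply, η_φ]

theorem W_ξ : C.W C.ξ = 0 := by simp [W_apply, h_ξ]

theorem η_W (X : 𝔛) : C.η (C.W X) = 0 := by simp [W_apply, η_φ]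

theorem φ_W (X : 𝔛) : C.φ (C.W X) = -C.h X := by simp [W_apply, φ_φ, η_h]

theorem S_eq (X : 𝔛) : C.S X = -C.ε • C.φ X - C.W X := by
  simp only [W_apply, h_apply, map_add, map_smul, φ_φ_S, φ_φ_φ]; module

theorem W_eq (X : 𝔛) : C.W X = -C.ε • C.φ X - C.S X := by rw [S_eq]; abel

/-- With W = -εφ - S, this is φS + Sφ = -2εφ² again, that is, ∇_ξ φ = 0. -/
theorem W_φ (X : 𝔛) : C.W (C.φ X) = -C.φ (C.W X) := by
  refine C.ext_g fun Y ↦ ?_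
  have h4 := C.g_T_ξ_left X Y
  rw [T_ξ_left] at h4
  simp only [W_eq, map_zero, LinearMap.zero_apply, map_sub, map_smul, LinearMap.sub_apply,
      LinearMap.smul_apply, smul_eq_mul, neg_smul, map_neg, LinearMap.neg_apply] at h4 ⊢
  linear_combination -h4

/-- The skew part of S is exactly -εφ, so -W is its symmetric part. -/
theorem g_W (X Y : 𝔛) : C.g (C.W X) Y = C.g X (C.W Y) := by
  have h1 := C.g_S_sub X Y
  have h2 := C.g_φ X Y
  simp only [W_eq, map_sub, map_smul, LinearMap.sub_apply, LinearMap.smul_apply, smul_eq_mul,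
    neg_smul, map_neg, LinearMap.neg_apply]
  linear_combination -h1 - C.ε * h2

theorem ε_smul_ε (X : 𝔛) : C.ε • C.ε • X = X := by rw [smul_smul, ε_sq, one_smul]

theorem h_eq (X : 𝔛) : C.h X = -C.φ (C.W X) := by rw [φ_W, neg_neg]

theorem h_φ (X : 𝔛) : C.h (C.φ X) = -C.φ (C.h X) := by simp [h_eq, W_φ]

theorem g_h (X Y : 𝔛) : C.g (C.h X) Y = C.g X (C.h Y) := by
  rw [h_eq, map_neg, LinearMap.neg_apply, g_φ, g_W, W_φ, h_eq]; simp

theorem h_h (X : 𝔛) : C.h (C.h X) = C.W (C.W X) := by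
  rw [h_eq, h_eq, map_neg, W_φ]; simp [φ_φ, η_W]

/-- The covariant derivative of `W = φ h`. -/
abbrev V : 𝔛 →ₗ[A] 𝔛 →ₗ[A] 𝔛 := C.covEnd C.W

theorem covEnd_S (X Y : 𝔛) : C.covEnd C.S X Y = -C.ε • C.T X Y - C.V X Y := by
  simp only [covEnd_apply, S_eq, map_sub, nab_smul, map_neg, D_ε]; module

theorem g_V_symm (X Y Z : 𝔛) : C.g (C.V X Y) Z = C.g Y (C.V X Z) :=
  C.g_covEnd_of_symm C.g_W X Y Z

theorem V_ξ_right (X : 𝔛) : C.V X C.ξ = -C.W (C.S X) := by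
  simp [covEnd_apply, W_ξ, S_apply]

theorem V_φ (X Y : 𝔛) : C.V X (C.φ Y) + C.φ (C.V X Y) = -C.W (C.T X Y) - C.T X (C.W Y) := by
  simp only [covEnd_apply, W_φ, map_sub, map_neg]; abel

theorem R_ξ_eq (X Y : 𝔛) : C.R X Y C.ξ =
    C.ε • (C.T Y X - C.T X Y) + C.V Y X - C.V X Y := by
  rw [R_ξ, covEnd_S, covEnd_S]; module

/-- The `(κ, μ)`-nullity condition. -/
def IsKappaMu (κ μ : A) : Prop :=
  (∀ X, C.D X κ = 0) ∧ (∀ X, C.D X μ = 0) ∧ ∀ X Y, C.R X Y C.ξ =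
    (C.ε * κ) • (C.η Y • X - C.η X • Y) + (C.ε * μ) • (C.η Y • C.h X - C.η X • C.h Y)

variable {C} {κ μ : A} (H : C.IsKappaMu κ μ)
include H

/-- The nullity condition at X = ξ is one relation `e` between ∇_ξ W, φ², W² and h. Conjugation F ↦
φFφ fixes ∇_ξ W and h but changes the sign of φ² and W². Subtracting the conjugated relation
therefore isolates W². -/
theorem IsKappaMu.W_W (X : 𝔛) : C.W (C.W X) = (C.ε * κ - 1) • C.φ (C.φ X) := by
  have e (X : 𝔛) : -C.V C.ξ X + C.φ (C.φ X) + C.W (C.W X) =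
      (C.ε * κ) • C.φ (C.φ X) - (C.ε * μ) • C.h X := by
    have h1 := H.2.2 C.ξ X
    rw [R_ξ_eq, T_ξ_left, T_ξ_right, V_ξ_right, S_eq, h_ξ, η_ξ] at h1
    simp only [map_sub, map_smul, W_φ, φ_φ, φ_W] at h1 ⊢
    linear_combination (norm := module) h1 - C.ε_smul_ε (-X + C.η X • C.ξ)
  have h1 := C.V_φ C.ξ X
  have h2 := C.φ_φ (C.V C.ξ X)
  have h3 : C.η (C.V C.ξ X) = 0 := by
    rw [η_eq, g_V_symm, V_ξ_right, S_ξ]; simp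
  have h4 := congrArg C.φ (e (C.φ X))
  rw [T_ξ_left, T_ξ_left, map_zero, neg_zero, sub_zero] at h1
  rw [h3, zero_smul, add_zero] at h2
  have h5 : C.φ (C.V C.ξ (C.φ X)) = C.V C.ξ X := by
    rw [eq_neg_of_add_eq_zero_left h1, map_neg, h2, neg_neg]
  have h6 := e X
  refine two_smul_cancel (A := A) ?_
  simp only [map_add, map_sub, map_neg, map_smul, h5, φ_φ_φ, W_φ, h_φ, φ_φ (X := C.W (C.W X)),
    φ_φ (X := C.h X), η_W, η_h] at h4
  linear_combination (norm := module) h6 - h4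

end ContactCalculus

/-! ### The horizontal part of ∇φ: closedness against the Codazzi-type equation for φh. -/

namespace ContactCalculus

open MetricCalculus

variable {A 𝔛 : Type*} [CommRing A] [Algebra ℝ A] [AddCommGroup 𝔛] [Module A 𝔛]

section

variable (C : ContactCalculus A 𝔛) {X Y Z : 𝔛}

theorem φ_φ_of_horizontal (hX : C.η X = 0) : C.φ (C.φ X) = -X := by simp [φ_φ, hX]

theorem g_T_φ (X : 𝔛) (hY : C.η Y = 0) (hZ : C.η Z = 0) :
    C.g (C.T X (C.φ Y)) Z = C.g (C.T X Y) (C.φ Z) := by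
  rw [eq_sub_of_add_eq (C.T_φ X Y), hY]
  simp [g_φ, g_ξ_left, hZ]

theorem g_T_φ_φ (X : 𝔛) (hY : C.η Y = 0) (hZ : C.η Z = 0) :
    C.g (C.T X (C.φ Y)) (C.φ Z) = -C.g (C.T X Y) Z := by
  rw [C.g_T_φ X hY (C.η_φ Z), C.φ_φ_of_horizontal hZ, map_neg]

/-- The fundamental two-form is quasi-Kähler along the contact distribution. -/
theorem g_T_quasi (hX : C.η X = 0) (hY : C.η Y = 0) (hZ : C.η Z = 0) :
    C.g (C.T X Y) Z + C.g (C.T (C.φ X) (C.φ Y)) Z = 0 := by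
  refine two_mul_cancel ?_
  -- Closedness on (X,Y,Z) and on the three triples obtained by applying φ to two entries; with
  -- these signs only derivatives along X and φX survive.
  linear_combination C.g_T_cyclic X Y Z - C.g_T_cyclic X (C.φ Y) (C.φ Z)
    + C.g_T_cyclic (C.φ X) Y (C.φ Z) + C.g_T_cyclic (C.φ X) (C.φ Y) Z
    + C.g_T_φ_φ X hY hZ + C.g_T_φ (C.φ X) hY hZ - C.g_T_φ_φ Y hZ hX + C.g_T_φ (C.φ Y) hZ hX
    - C.g_T_φ_φ Z hX hY - C.g_T_φ (C.φ Z) hX hY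

theorem g_T_swap (X Y Z : 𝔛) : C.g (C.T X Y) Z = -C.g (C.T X Z) Y := by
  rw [g_T_skew, g_symm]

theorem g_V_φ (X Y Z : 𝔛) : C.g (C.V X (C.φ Y)) Z - C.g (C.V X Y) (C.φ Z) =
    -C.g (C.T X Y) (C.W Z) - C.g (C.T X (C.W Y)) Z := by
  rw [eq_sub_of_add_eq (C.V_φ X Y)]
  simp only [map_sub, map_neg, LinearMap.sub_apply, LinearMap.neg_apply, g_φ, g_W]; ring

end

namespace IsKappaMu

variable {C : ContactCalculus A 𝔛} {κ μ : A} (H : C.IsKappaMu κ μ) {X Y Z : 𝔛}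
include H

/-- A Codazzi equation with a defect: for horizontal X, Y the nullity condition is R(X,Y)ξ = 0,
which equates the alternation of ∇W with that of -ε∇φ, and closedness of Φ collapses the latter to
one term. -/
theorem g_V_sub (hX : C.η X = 0) (hY : C.η Y = 0) (Z : 𝔛) :
    C.g (C.V X Y) Z - C.g (C.V Y X) Z = C.ε * C.g (C.T Z X) Y := by
  have h1 := congrArg (C.g · Z) (H.2.2 X Y)
  simp only [R_ξ_eq, hX, hY, zero_smul, sub_zero, smul_zero, add_zero, map_add, map_sub, map_smul,
    map_zero, LinearMap.zero_apply, LinearMap.add_apply, LinearMap.sub_apply, LinearMap.smul_apply,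
    smul_eq_mul] at h1
  linear_combination -h1 + C.ε * C.g_T_swap Y X Z - C.ε * C.g_T_cyclic X Y Z

/-- Use `g_V_sub` for the pairs (Y,Z), (φY,φZ), (Y,φZ), (φY,Z), tested on X or φX, and the
derivative of Wφ + φW = 0 to carry φ across ∇W. All ∇W terms cancel; the quasi-Kähler and closedness
identities reduce the rest to twice the claim. -/
theorem g_T_h (hX : C.η X = 0) (hY : C.η Y = 0) (hZ : C.η Z = 0) :
    C.g (C.T (C.h X) Y) Z = 0 := by
  have W_eq (X) : C.W X = C.φ (C.h X) := rfl
  have hh := C.η_h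
  have q1 := C.g_V_φ Y Z (C.φ X)
  have q2 := C.g_V_φ Z Y (C.φ X)
  have q3 := C.g_V_φ (C.φ Y) Z X
  have q4 := C.g_V_φ (C.φ Z) Y X
  have c1 := H.g_V_sub hY hZ X
  have c2 := H.g_V_sub (C.η_φ Y) (C.η_φ Z) X
  have c3 := H.g_V_sub hY (C.η_φ Z) (C.φ X)
  have c4 := H.g_V_sub (C.η_φ Y) hZ (C.φ X)
  rw [C.φ_φ_of_horizontal hX, W_φ, φ_W, neg_neg, W_eq, C.g_T_φ_φ _ (hh _) hX, map_neg] at q1 q2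
  rw [W_eq, W_eq, ← C.g_T_φ _ hZ (hh X)] at q3
  rw [W_eq, W_eq, ← C.g_T_φ _ hY (hh X)] at q4
  rw [C.g_T_φ_φ _ hY hZ] at c2
  rw [← C.g_T_φ _ hY hZ] at c3
  refine two_mul_cancel ?_
  linear_combination C.g_T_cyclic (C.h X) Y Z - C.g_T_cyclic (C.h X) (C.φ Y) (C.φ Z)
    + c1 - c2 + c3 + c4 - q1 + q2 + q3 - q4 - C.g_T_swap Z Y (C.h X)
    + C.g_T_swap (C.φ Z) (C.φ Y) (C.h X)
    + 2 * C.ε * C.g_T_quasi hX hY hZ - C.g_T_quasi hY (hh Z) hX + C.g_T_quasi hZ (hh Y) hX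
    + C.g_T_φ_φ (C.h X) hY hZ

end IsKappaMu

/-! ### Closed formulas for ∇φ and ∇(φh), and the curvature commutators. -/

section

variable (C : ContactCalculus A 𝔛)

/-- The endomorphism field `ε + h`. -/
def P : 𝔛 →ₗ[A] 𝔛 := C.ε • LinearMap.id + C.h

theorem P_apply (X : 𝔛) : C.P X = C.ε • X + C.h X := rfl

theorem φ_S (X : 𝔛) : C.φ (C.S X) = C.h X - C.ε • C.φ (C.φ X) := by rw [h_apply]; abel

theorem S_eq_φ_P (X : 𝔛) : C.S X = -C.φ (C.P X) := by
  rw [S_eq, P_apply, map_add, map_smul, W_apply]; module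

theorem V_ξ_right_eq (X : 𝔛) : C.V X C.ξ = C.h (C.P X) := by
  rw [V_ξ_right, S_eq, P_apply, map_add, h_h, map_smul, h_eq, map_sub, map_smul, W_φ]; module

theorem η_horizontal (X : 𝔛) : C.η (X - C.η X • C.ξ) = 0 := by simp [η_ξ]

/-- The derivative of W² = cφ² along X. -/
theorem V_W (X Y : 𝔛) {c : A} (hc : C.D X c = 0)
    (hW : ∀ X, C.W (C.W X) = c • C.φ (C.φ X)) :
    C.V X (C.W Y) + C.W (C.V X Y) = c • (C.T X (C.φ Y) + C.φ (C.T X Y)) := by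
  have h1 := congrArg (C.nab X) (hW Y)
  have h2 := hW (C.nab X Y)
  rw [nab_smul, hc] at h1
  simp only [covEnd_apply, map_sub]
  linear_combination (norm := module) h1 - h2

end

namespace IsKappaMu

variable {C : ContactCalculus A 𝔛} {κ μ : A} (H : C.IsKappaMu κ μ) {X Y Z U : 𝔛}
include H

theorem h_h_of_horizontal (hX : C.η X = 0) : C.h (C.h X) = (1 - C.ε * κ) • X := by
  rw [h_h, H.W_W, C.φ_φ_of_horizontal hX]; module

/-- Once W² is known, the nullity condition at X = ξ can be solved for ∇_ξ W. -/
theorem V_ξ_left (Y : 𝔛) : C.V C.ξ Y = (C.ε * μ) • C.h Y := by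
  have h1 := H.2.2 C.ξ Y
  have h2 := H.W_W Y
  rw [R_ξ_eq, T_ξ_left, T_ξ_right, V_ξ_right_eq, h_ξ, η_ξ, φ_S, P_apply, map_add, map_smul,
    h_h, h2, φ_φ] at h1
  linear_combination (norm := module) -h1 + C.ε_smul_ε (-Y + C.η Y • C.ξ)

variable {a : A} (ha : a * (1 - C.ε * κ) = 1)
include ha

/-- On ker η one has h² = 1 - εκ, with inverse `a`; hence `g_T_h` applied to hX reaches every
horizontal direction. -/
theorem g_T_eq_zero (hX : C.η X = 0) (hY : C.η Y = 0) (hZ : C.η Z = 0) :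
    C.g (C.T X Y) Z = 0 := by
  have h1 := H.g_T_h (C.η_h X) hY hZ
  rw [H.h_h_of_horizontal hX] at h1
  simp only [map_smul, LinearMap.smul_apply, smul_eq_mul] at h1
  linear_combination a * h1 - C.g (C.T X Y) Z * ha

/-- With no purely horizontal part, ∇φ is fixed by its values on ξ: ∇_ξ φ = 0, (∇_X φ)ξ = -φSX, and
skewness for the ξ-component. -/
theorem T_eq (X Y : 𝔛) :
    C.T X Y = (C.ε * C.g (C.P X) Y) • C.ξ - C.η Y • C.P X := by
  refine C.ext_g fun Z ↦ ?_
  have h1 := H.g_T_eq_zero ha (C.η_horizontal X) (C.η_horizontal Y) (C.η_horizontal Z)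
  have h2 := C.g_T_skew X Y C.ξ
  simp only [map_sub, map_smul, LinearMap.sub_apply, LinearMap.smul_apply, T_ξ_left, T_ξ_right,
    φ_S, h_ξ, φ_φ, η_ξ, smul_eq_mul, P_apply, map_neg, map_add, LinearMap.neg_apply,
    LinearMap.add_apply, map_zero, LinearMap.zero_apply, g_ξ_left, η_h, g_ξ] at h1 h2 ⊢
  have h4 := C.g_symm X Y
  have h5 := C.g_symm (C.h X) Y
  have h6 := C.ε_sq
  grind

theorem g_V_comm (hX : C.η X = 0) (hY : C.η Y = 0) (hZ : C.η Z = 0) :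
    C.g (C.V X Y) Z = C.g (C.V Y X) Z := by
  have h1 := H.g_V_sub hX hY Z
  rw [H.g_T_eq_zero ha hZ hX hY] at h1
  linear_combination h1

omit ha in
theorem g_V_W (X : 𝔛) (hY : C.η Y = 0) (hZ : C.η Z = 0) :
    C.g (C.V X (C.W Y)) Z = -C.g (C.V X Y) (C.W Z) := by
  have hc : C.D X (C.ε * κ - 1) = 0 := by simp [Derivation.leibniz, C.D_ε, H.1]
  have h1 := congrArg (C.g · Z) (C.V_W X Y hc H.W_W)
  have h2 := C.g_T_φ X hY hZ
  simp only [map_add, map_smul, LinearMap.add_apply, LinearMap.smul_apply, g_W, g_φ, h2,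
    add_neg_cancel, smul_zero] at h1
  linear_combination h1

/-- Write v(X,Y,Z) = g((∇_X W)Y,Z), totally symmetric on ker η. By `g_V_W`, v(X,WY,Z) = -v(X,Y,WZ) =
v(WX,Y,Z) = -v(X,WY,Z), so it is zero; W² = h² is an invertible scalar there, which removes W. -/
theorem g_V_eq_zero (hX : C.η X = 0) (hY : C.η Y = 0) (hZ : C.η Z = 0) :
    C.g (C.V X Y) Z = 0 := by
  have h0 {X Y Z : 𝔛} (hX : C.η X = 0) (hY : C.η Y = 0) (hZ : C.η Z = 0) :
      C.g (C.V X (C.W Y)) Z = 0 := by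
    refine two_mul_cancel ?_
    have e1 := H.g_V_W X hY hZ
    have e2 := H.g_V_W Y hX hZ
    have e3 := H.g_V_W Z hX hY
    have c1 := H.g_V_comm ha hX hY (C.η_W Z)
    have c3 := H.g_V_comm ha hY (C.η_W X) hZ
    have c4 := H.g_V_comm ha hX hZ (C.η_W Y)
    have s2 := C.g_V_symm X (C.W Y) Z
    have s3 := C.g_V_symm (C.W X) Y Z
    have g1 := C.g_symm (C.W Y) (C.V X Z)
    have g2 := C.g_symm Y (C.V (C.W X) Z)
    have c6 := H.g_V_comm ha hZ (C.η_W X) hY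
    linear_combination e1 - c1 - e2 + c3 + s3 + g2 - c6 + e3 + s2 + g1 + c4
  have h1 := h0 hX (C.η_W Y) hZ
  rw [← h_h, H.h_h_of_horizontal hY] at h1
  simp only [map_smul, LinearMap.smul_apply, smul_eq_mul] at h1
  linear_combination a * h1 - C.g (C.V X Y) Z * ha

theorem V_eq (X Y : 𝔛) :
    C.V X Y = (C.ε * C.g (C.h (C.P X)) Y) • C.ξ + C.η Y • C.h (C.P X)
      + (C.ε * μ * C.η X) • C.h Y := by
  refine C.ext_g fun Z ↦ ?_
  have h1 := H.g_V_eq_zero ha (C.η_horizontal X) (C.η_horizontal Y) (C.η_horizontal Z)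
  have h2 := C.g_V_symm X Y C.ξ
  simp only [map_sub, map_smul, LinearMap.sub_apply, LinearMap.smul_apply, H.V_ξ_left,
    V_ξ_right_eq, h_ξ, smul_eq_mul, map_add, smul_zero, sub_zero,
    LinearMap.add_apply, g_ξ_left, η_h, g_ξ, mul_zero] at h1 h2 ⊢
  have h4 := C.g_symm Y (C.h (C.P X))
  linear_combination h1 + C.η Z * h2 + C.η Z * h4 - C.g (C.h (C.P X)) Y * C.η Z * C.ε_sq

/-- The commutator of the curvature operator and `φ`. -/
theorem g_R_φ (hZ : C.η Z = 0) (hU : C.η U = 0) (X Y : 𝔛) :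
    C.g (C.R X Y (C.φ Z)) U + C.g (C.R X Y Z) (C.φ U) =
      C.ε * (C.g (C.P Y) Z * C.g (C.S X) U - C.g (C.S X) Z * C.g (C.P Y) U) -
      C.ε * (C.g (C.P X) Z * C.g (C.S Y) U - C.g (C.S Y) Z * C.g (C.P X) U) := by
  have h1 := congrArg (C.g · U) (C.R_comm C.φ X Y Z)
  have h2 (X Y : 𝔛) := C.η_nab X Y
  simp only [H.T_eq ha, map_sub, map_add, nab_smul, map_smul, hZ, zero_smul, C.η_nab, map_zero,
    LinearMap.sub_apply, LinearMap.add_apply, LinearMap.smul_apply, C.g_ξ_left, hU, mul_zero,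
    LinearMap.zero_apply, smul_eq_mul, ← S_apply, C.g_φ] at h1
  linear_combination h1

/-- The commutator of the curvature operator and `W = φ h`. -/
theorem g_R_W (hX : C.η X = 0) (hY : C.η Y = 0) (hZ : C.η Z = 0) (hU : C.η U = 0) :
    C.g (C.R X Y (C.W Z)) U - C.g (C.R X Y Z) (C.W U) =
      C.ε * (C.g (C.h (C.P Y)) Z * C.g (C.S X) U + C.g (C.S X) Z * C.g (C.h (C.P Y)) U) -
      C.ε * (C.g (C.h (C.P X)) Z * C.g (C.S Y) U + C.g (C.S Y) Z * C.g (C.h (C.P X)) U) +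
      2 * C.ε * μ * C.g X (C.φ Y) * C.g (C.h Z) U := by
  have h1 := congrArg (C.g · U) (C.R_comm C.W X Y Z)
  have h2 := C.D_η_alt X Y
  simp only [H.V_eq ha, map_sub, map_add, nab_smul, map_smul, hZ, hX, hY, zero_smul, C.η_nab,
    map_zero, LinearMap.sub_apply, LinearMap.add_apply, LinearMap.smul_apply, C.g_ξ_left, hU,
    LinearMap.zero_apply, mul_zero, smul_eq_mul, ← S_apply, C.g_W] at h1 h2
  linear_combination h1 + C.ε * μ * C.g (C.h Z) U * h2

end IsKappaMu
end ContactCalculus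

/-! ### Linear algebra at a point: curvature on eigenvectors of h. -/

/-- The curvature tensor of a `(κ, μ)`-contact pseudo-metric manifold at a point, together with
the structure tensors at this point and the commutators of the curvature operators with `φ`
and `φ h` on the contact hyperplane. -/
structure KappaMuTensor (V : Type*) [AddCommGroup V] [Module ℝ V] where
  g : V →ₗ[ℝ] V →ₗ[ℝ] ℝ
  R : V →ₗ[ℝ] V →ₗ[ℝ] V →ₗ[ℝ] V
  φ : V →ₗ[ℝ] V
  h : V →ₗ[ℝ] V
  ξ : V
  η : V →ₗ[ℝ] ℝ
  ε : ℝ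
  κ : ℝ
  μ : ℝ
  g_symm : ∀ X Y, g X Y = g Y X
  g_nondeg : ∀ X, (∀ Y, g X Y = 0) → X = 0
  R_swap : ∀ X Y Z, R X Y Z = -R Y X Z
  bianchi : ∀ X Y Z, R X Y Z + R Y Z X + R Z X Y = 0
  g_R_skew : ∀ X Y Z W, g (R X Y Z) W = -g Z (R X Y W)
  g_R_pair : ∀ X Y Z W, g (R X Y Z) W = g (R Z W X) Y
  ε_sq : ε * ε = 1
  η_ξ : η ξ = 1
  φ_φ : ∀ X, φ (φ X) = -X + η X • ξ
  η_φ : ∀ X, η (φ X) = 0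
  g_ξ : ∀ X, g X ξ = ε * η X
  g_φ : ∀ X Y, g (φ X) Y = -g X (φ Y)
  h_ξ : h ξ = 0
  η_h : ∀ X, η (h X) = 0
  h_φ : ∀ X, h (φ X) = -φ (h X)
  g_h : ∀ X Y, g (h X) Y = g X (h Y)
  h_h : ∀ X, h (h X) = (ε * κ - 1) • φ (φ X)
  R_ξ : ∀ X Y, R X Y ξ = (ε * κ) • (η Y • X - η X • Y) + (ε * μ) • (η Y • h X - η X • h Y)
  g_R_φ : ∀ X Y Z U, η Z = 0 → η U = 0 →
    g (R X Y (φ Z)) U + g (R X Y Z) (φ U) =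
      ε * (g (ε • X + h X) Z * g (φ (ε • Y + h Y)) U - g (φ (ε • Y + h Y)) Z * g (ε • X + h X) U) -
      ε * (g (ε • Y + h Y) Z * g (φ (ε • X + h X)) U - g (φ (ε • X + h X)) Z * g (ε • Y + h Y) U)
  g_R_W : ∀ X Y Z U, η X = 0 → η Y = 0 → η Z = 0 → η U = 0 →
    g (R X Y (φ (h Z))) U - g (R X Y Z) (φ (h U)) =
      ε * (g (h (ε • X + h X)) Z * g (φ (ε • Y + h Y)) U
        + g (φ (ε • Y + h Y)) Z * g (h (ε • X + h X)) U) -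
      ε * (g (h (ε • Y + h Y)) Z * g (φ (ε • X + h X)) U
        + g (φ (ε • X + h X)) Z * g (h (ε • Y + h Y)) U) +
      2 * ε * μ * g X (φ Y) * g (h Z) U

namespace KappaMuTensor

variable {V : Type*} [AddCommGroup V] [Module ℝ V] (C : KappaMuTensor V)

/-- `c` is one of the two eigenvalues `±√(1 - εκ)` of `h` on the contact hyperplane. -/
def IsEigenvalue (c : ℝ) : Prop := c ≠ 0 ∧ c * c = 1 - C.ε * C.κ

variable {C} {c : ℝ} {X Y Z U : V}

theorem IsEigenvalue.neg (hc : C.IsEigenvalue c) : C.IsEigenvalue (-c) :=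
  ⟨neg_ne_zero.2 hc.1, by rw [neg_mul_neg, hc.2]⟩

theorem η_eq_zero (hc : c ≠ 0) (hX : C.h X = c • X) : C.η X = 0 := by
  have h1 := C.η_h X
  rw [hX, map_smul, smul_eq_mul] at h1
  exact (mul_eq_zero.1 h1).resolve_left hc

theorem h_φ_of_eigen (hX : C.h X = c • X) : C.h (C.φ X) = (-c) • C.φ X := by
  rw [C.h_φ, hX, map_smul, neg_smul]

theorem φ_φ_of_eigen (hc : c ≠ 0) (hX : C.h X = c • X) : C.φ (C.φ X) = -X := by
  rw [C.φ_φ, η_eq_zero hc hX, zero_smul, add_zero]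

theorem g_eq_zero_of_eigen (hc : c ≠ 0) (hX : C.h X = c • X) (hY : C.h Y = (-c) • Y) :
    C.g X Y = 0 := by
  have h1 := C.g_h X Y
  rw [hX, hY] at h1
  simp only [map_smul, LinearMap.smul_apply, smul_eq_mul] at h1
  refine (mul_eq_zero.1 (?_ : c * C.g X Y = 0)).resolve_left hc
  linarith

theorem g_φ_φ_of_eigen (hc : c ≠ 0) (hY : C.h Y = c • Y) :
    C.g (C.φ X) (C.φ Y) = C.g X Y := by
  rw [C.g_φ, φ_φ_of_eigen hc hY, map_neg, neg_neg]

theorem g_φ_eq_zero_of_eigen (hc : c ≠ 0) (hX : C.h X = c • X) (hY : C.h Y = c • Y) :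
    C.g (C.φ X) Y = 0 := by
  rw [C.g_symm]; exact g_eq_zero_of_eigen hc hY (h_φ_of_eigen hX)

/-- Components `R(X, Y, Z, φU)` of the curvature, for eigenvectors of `h`. -/
theorem g_R_φ_of_eigen {a b : ℝ} (hc : c ≠ 0) (ha0 : a ≠ 0) (hb0 : b ≠ 0) (hX : C.h X = a • X)
    (hY : C.h Y = b • Y) (hZ : C.h Z = c • Z) (hU : C.h U = c • U) :
    2 * c * C.g (C.R X Y Z) (C.φ U) =
      C.ε * (C.ε + a) * (C.ε + b) * (C.g X Z * C.g (C.φ Y) U * (c - a)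
        - C.g (C.φ Y) Z * C.g X U * (c + a) - C.g Y Z * C.g (C.φ X) U * (c - b)
        + C.g (C.φ X) Z * C.g Y U * (c + b))
      - 2 * C.ε * C.μ * c * C.g X (C.φ Y) * C.g Z U := by
  have h1 := C.g_R_φ X Y Z U (η_eq_zero hc hZ) (η_eq_zero hc hU)
  have h2 := C.g_R_W X Y Z U (η_eq_zero ha0 hX) (η_eq_zero hb0 hY) (η_eq_zero hc hZ)
    (η_eq_zero hc hU)
  simp only [hX, hY, hZ, hU, map_smul, map_add, LinearMap.smul_apply, LinearMap.add_apply,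
    smul_eq_mul] at h1 h2
  -- On the c-eigenspace `h1` is the sum of g(R(X,Y)φZ,U) and g(R(X,Y)Z,φU), and `h2` is c times
  -- their difference.
  linear_combination c * h1 - h2

/-- `g_R_φ_of_eigen` with φU, which lies in the c-eigenspace, in place of U, since φ(φU) = -U. The
constant κ comes from (ε-c)(ε+c) = 1 - c² = εκ. -/
theorem g_R_mixed (hc : C.IsEigenvalue c) (hX : C.h X = (-c) • X) (hY : C.h Y = c • Y)
    (hZ : C.h Z = c • Z) (hU : C.h U = (-c) • U) :
    C.g (C.R X Y Z) U =
      C.κ * C.g (C.φ X) Z * C.g (C.φ Y) U - C.ε * C.μ * C.g X (C.φ Y) * C.g (C.φ Z) U := by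
  have hU' : C.h (C.φ U) = c • C.φ U := by simpa using h_φ_of_eigen hU
  have h1 := g_R_φ_of_eigen hc.1 (neg_ne_zero.2 hc.1) hc.1 hX hY hZ hU'
  rw [φ_φ_of_eigen (neg_ne_zero.2 hc.1) hU, map_neg, C.g_symm X Z,
    g_eq_zero_of_eigen hc.1 hZ hX, g_φ_eq_zero_of_eigen hc.1 hY hZ] at h1
  have h2 := C.ε_sq
  have h3 := C.g_φ Y U
  have h4 := C.g_φ Z U
  have h5 := hc.2
  refine mul_left_cancel₀ (mul_ne_zero two_ne_zero hc.1) ?_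
  have h6 : (C.ε + -c) * (C.ε + c) = C.ε * C.κ := by linear_combination h2 - h5
  rw [h3, h4]
  linear_combination -h1 - C.ε * C.g (C.φ X) Z * C.g Y (C.φ U) * (2 * c) * h6
    - C.κ * C.g (C.φ X) Z * C.g Y (C.φ U) * (2 * c) * h2

/-- The same substitution. Every term on the right either carries a factor c - c or pairs the
c-eigenspace with its image under φ, which is orthogonal to it. -/
theorem g_R_eq_zero (hc : C.IsEigenvalue c) (hX : C.h X = c • X) (hY : C.h Y = c • Y)
    (hZ : C.h Z = c • Z) (hU : C.h U = (-c) • U) : C.g (C.R X Y Z) U = 0 := by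
  have hU' : C.h (C.φ U) = c • C.φ U := by simpa using h_φ_of_eigen hU
  have h1 := g_R_φ_of_eigen hc.1 hc.1 hc.1 hX hY hZ hU'
  rw [φ_φ_of_eigen (neg_ne_zero.2 hc.1) hU, map_neg, C.g_symm X (C.φ Y),
    g_φ_eq_zero_of_eigen hc.1 hX hZ, g_φ_eq_zero_of_eigen hc.1 hY hZ,
    g_φ_eq_zero_of_eigen hc.1 hY hX] at h1
  refine mul_left_cancel₀ (mul_ne_zero two_ne_zero hc.1) ?_
  linear_combination -h1

/-- The commutator with φ relates R(X,Y,Z,U) to R(X,Y,φZ,φU). Pair symmetry and the Bianchi identity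
split the latter into two mixed components, given by `g_R_mixed`. -/
theorem g_R_same (hc : C.IsEigenvalue c) (hX : C.h X = c • X) (hY : C.h Y = c • Y)
    (hZ : C.h Z = c • Z) (hU : C.h U = c • U) :
    C.g (C.R X Y Z) U =
      (2 * C.ε + 2 * c - C.ε * C.μ) * (C.g Y Z * C.g X U - C.g X Z * C.g Y U) := by
  have fX := h_φ_of_eigen hX
  have fZ := h_φ_of_eigen hZ
  have fU := h_φ_of_eigen hU
  have h1 := C.g_R_φ X Y Z (C.φ U) (η_eq_zero hc.1 hZ) (C.η_φ U)
  rw [φ_φ_of_eigen hc.1 hU, map_neg] at h1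
  simp only [hX, hY, map_smul, map_add, LinearMap.smul_apply, LinearMap.add_apply,
    smul_eq_mul, g_φ_eq_zero_of_eigen hc.1 hX hZ, g_φ_eq_zero_of_eigen hc.1 hY hZ,
    g_φ_φ_of_eigen hc.1 hU] at h1
  have h2 := C.g_R_pair X Y (C.φ Z) (C.φ U)
  have h3 := congrArg (C.g · Y) (C.bianchi (C.φ Z) (C.φ U) X)
  have h4 := C.g_R_skew (C.φ U) X (C.φ Z) Y
  rw [C.g_symm (C.φ Z)] at h4
  have h5 := C.g_R_skew (C.φ Z) X (C.φ U) Y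
  rw [C.g_symm (C.φ U)] at h5
  have h6 := congrArg (C.g · Y) (C.R_swap X (C.φ Z) (C.φ U))
  rw [g_R_mixed hc fU hX hY fZ] at h4
  rw [g_R_mixed hc fZ hX hY fU] at h5
  simp only [map_add, map_zero, map_neg, LinearMap.add_apply, LinearMap.zero_apply,
    LinearMap.neg_apply] at h3 h6
  simp only [g_φ_φ_of_eigen hc.1 hU, g_φ_φ_of_eigen hc.1 hZ, g_φ_φ_of_eigen hc.1 hX,
    φ_φ_of_eigen hc.1 hU, φ_φ_of_eigen hc.1 hZ, map_neg, LinearMap.neg_apply] at h4 h5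
  have e2 := C.g_symm U Y
  have e3 := C.g_symm Z X
  have e4 := C.g_symm Z Y
  -- The commutator contributes ε(ε+c)²; its -κ cancels against the κ of the mixed components.
  have h7 : C.ε * (C.ε + c) * (C.ε + c) = 2 * C.ε + 2 * c - C.κ := by
    linear_combination (C.ε + 2 * c - C.κ) * C.ε_sq + C.ε * hc.2
  rw [C.g_symm U X, e2] at h4
  rw [e3, e4] at h5
  linear_combination -h1 + h2 + h3 - h4 + h5 - h6
    + (C.g Y Z * C.g X U - C.g X Z * C.g Y U) * h7

theorem η_eq (X : V) : C.η X = C.ε * C.g X C.ξ := by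
  rw [C.g_ξ, ← mul_assoc, C.ε_sq, one_mul]

theorem g_R_ξ_left {X : V} (hX : C.η X = 0) (Y : V) :
    C.g (C.R C.ξ X Y) C.ξ = C.ε * C.κ * C.g X Y + C.ε * C.μ * C.g (C.h X) Y := by
  rw [C.g_R_skew, C.R_ξ, hX, C.η_ξ, C.h_ξ, C.g_symm X, C.g_symm (C.h X)]
  simp only [zero_smul, one_smul, zero_sub, map_add, map_smul, map_neg, smul_eq_mul]; ring

end KappaMuTensor

/-! ### The Ricci tensor as a trace over ξ and the two eigenspaces of h. -/

namespace KappaMuTensor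

section Ricci

variable {V : Type*} [AddCommGroup V] [Module ℝ V] {C : KappaMuTensor V} {c : ℝ}

theorem φ_h_φ (X : V) : C.φ (C.h (C.φ X)) = C.h X := by
  rw [C.h_φ, map_neg, C.φ_φ, C.η_h]; simp

theorem h_φ_φ (X : V) : C.h (C.φ (C.φ X)) = -C.h X := by
  rw [C.φ_φ, map_add, map_neg, map_smul, C.h_ξ, smul_zero, add_zero]

variable (C) in
/-- The projection onto the eigenspace of `h` for an eigenvalue `c`. -/
noncomputable def proj (c : ℝ) : V →ₗ[ℝ] V := (1 / 2 : ℝ) • (c⁻¹ • C.h - C.φ ∘ₗ C.φ)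

theorem proj_apply (c : ℝ) (X : V) : C.proj c X = (1 / 2 : ℝ) • (c⁻¹ • C.h X - C.φ (C.φ X)) := rfl

theorem h_proj (hc : C.IsEigenvalue c) (X : V) : C.h (C.proj c X) = c • C.proj c X := by
  have h0 := hc.1
  have h1 : C.ε * C.κ - 1 = -(c * c) := by linear_combination hc.2
  simp only [proj_apply, map_smul, map_sub, h_φ_φ, C.h_h, h1]
  match_scalars <;> field_simp

theorem proj_of_eigen (hc : C.IsEigenvalue c) {X : V} (hX : C.h X = c • X) : C.proj c X = X := by
  have h0 := hc.1
  rw [proj_apply, φ_φ_of_eigen h0 hX, hX]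
  match_scalars
  field_simp
  norm_num

theorem proj_add_proj (c : ℝ) (X : V) :
    C.η X • C.ξ + (C.proj c X + C.proj (-c) X) = X := by
  rw [proj_apply, proj_apply, C.φ_φ, inv_neg]; module

theorem g_proj (c : ℝ) (X Y : V) : C.g (C.proj c X) Y = C.g X (C.proj c Y) := by
  simp [proj_apply, C.g_h, C.g_φ]

/-- Two linear maps agree if they do so on `ξ` and on the eigenvectors of `h`. -/
theorem ext_eigen {W : Type*} [AddCommGroup W] [Module ℝ W] (hc : C.IsEigenvalue c)
    {f f' : V →ₗ[ℝ] W} (h0 : f C.ξ = f' C.ξ) (h1 : ∀ X, C.h X = c • X → f X = f' X)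
    (h2 : ∀ X, C.h X = (-c) • X → f X = f' X) : f = f' := by
  ext X
  rw [← proj_add_proj (C := C) c X]
  simp only [map_add, map_smul, h0, h1 _ (h_proj hc X), h2 _ (h_proj hc.neg X)]

variable [Module.Finite ℝ V]

theorem trace_φ_φ : LinearMap.trace ℝ V (C.φ ∘ₗ C.φ) = 1 - Module.finrank ℝ V := by
  have h1 : C.φ ∘ₗ C.φ = C.η.smulRight C.ξ - LinearMap.id := by
    ext X; simp [C.φ_φ]; abel
  rw [h1, map_sub, LinearMap.trace_smulRight, C.η_ξ, LinearMap.trace_id]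

/-- φhφ = h while hφφ = -h, and the trace is cyclic. -/
theorem trace_h : LinearMap.trace ℝ V C.h = 0 := by
  have h1 : C.φ ∘ₗ (C.h ∘ₗ C.φ) = C.h := by ext X; exact φ_h_φ X
  have h2 : (C.h ∘ₗ C.φ) ∘ₗ C.φ = -C.h := by ext X; exact h_φ_φ X
  have h3 := LinearMap.trace_comp_comm' C.φ (C.h ∘ₗ C.φ)
  rw [h1, h2, map_neg] at h3
  linarith

theorem trace_proj (c : ℝ) :
    LinearMap.trace ℝ V (C.proj c) = ((Module.finrank ℝ V : ℝ) - 1) / 2 := by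
  rw [proj, map_smul, map_sub, map_smul, trace_h, trace_φ_φ]; simp; ring

/-- The projection P is idempotent and self-adjoint, so tr(FP) = tr(PFP), and PFP depends only on
g(FZ,U) for eigenvectors Z, U. This replaces a pseudo-orthonormal basis and its signs. -/
theorem trace_comp_proj_eq (hc : C.IsEigenvalue c) {F B : V →ₗ[ℝ] V}
    (h : ∀ Z U, C.h Z = c • Z → C.h U = c • U → C.g (F Z) U = C.g (B Z) U) :
    LinearMap.trace ℝ V (F ∘ₗ C.proj c) = LinearMap.trace ℝ V (B ∘ₗ C.proj c) := by
  have h1 (F : V →ₗ[ℝ] V) : LinearMap.trace ℝ V (F ∘ₗ C.proj c) =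
      LinearMap.trace ℝ V (C.proj c ∘ₗ F ∘ₗ C.proj c) := by
    have h2 : F ∘ₗ C.proj c = (F ∘ₗ C.proj c) ∘ₗ C.proj c := by
      ext X; simp [proj_of_eigen hc (h_proj hc X)]
    conv_lhs => rw [h2]
    rw [LinearMap.trace_comp_comm']
  rw [h1, h1 B]
  congr 1
  ext X
  refine sub_eq_zero.1 (C.g_nondeg _ fun Y ↦ ?_)
  simp only [LinearMap.comp_apply, map_sub, LinearMap.sub_apply, g_proj]
  rw [h _ _ (h_proj hc X) (h_proj hc Y), sub_self]

/-- The trace of an endomorphism, computed on the eigenspaces of `h`. -/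
theorem trace_eq (hc : C.IsEigenvalue c) {F B B' : V →ₗ[ℝ] V}
    (h : ∀ Z U, C.h Z = c • Z → C.h U = c • U → C.g (F Z) U = C.g (B Z) U)
    (h' : ∀ Z U, C.h Z = (-c) • Z → C.h U = (-c) • U → C.g (F Z) U = C.g (B' Z) U) :
    LinearMap.trace ℝ V F = C.η (F C.ξ) + LinearMap.trace ℝ V (B ∘ₗ C.proj c)
      + LinearMap.trace ℝ V (B' ∘ₗ C.proj (-c)) := by
  have h1 : F = C.η.smulRight (F C.ξ) + (F ∘ₗ C.proj c + F ∘ₗ C.proj (-c)) := by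
    ext X
    conv_lhs => rw [← proj_add_proj (C := C) c X]
    simp
  conv_lhs => rw [h1]
  rw [map_add, map_add, LinearMap.trace_smulRight, trace_comp_proj_eq hc h,
    trace_comp_proj_eq hc.neg h', add_assoc]

variable (C) in
/-- The Ricci tensor. -/
noncomputable def ric : V →ₗ[ℝ] V →ₗ[ℝ] ℝ :=
  LinearMap.mk₂ ℝ (fun X Y ↦ LinearMap.trace ℝ V ((C.R.flip X).flip Y))
    (fun X X' Y ↦ by
      rw [map_add]
      exact map_add (LinearMap.trace ℝ V) ((C.R.flip X).flip Y) ((C.R.flip X').flip Y))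
    (fun a X Y ↦ by
      rw [map_smul]
      exact map_smul (LinearMap.trace ℝ V) a ((C.R.flip X).flip Y))
    (by simp) (by simp)

theorem ric_apply (X Y : V) : C.ric X Y = LinearMap.trace ℝ V ((C.R.flip X).flip Y) := rfl

theorem ric_ξ_right (X : V) :
    C.ric X C.ξ = C.ε * C.κ * ((Module.finrank ℝ V : ℝ) - 1) * C.η X := by
  have h1 : (C.R.flip X).flip C.ξ =
      (C.ε * C.κ * C.η X) • LinearMap.id - C.η.smulRight ((C.ε * C.κ) • X)
      + ((C.ε * C.μ * C.η X) • C.h - C.η.smulRight ((C.ε * C.μ) • C.h X)) := by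
    ext Z
    simp only [LinearMap.flip_apply, C.R_ξ, LinearMap.add_apply, LinearMap.sub_apply,
      LinearMap.smul_apply, LinearMap.smulRight_apply, LinearMap.id_apply]
    module
  rw [ric_apply, h1]
  simp only [map_add, map_sub, map_smul, LinearMap.trace_smulRight, LinearMap.trace_id, trace_h,
    C.η_h, smul_eq_mul]
  ring

theorem ric_ξ_left (hc : C.IsEigenvalue c) {Y : V} (hY : C.h Y = c • Y) : C.ric C.ξ Y = 0 := by
  have h1 {c : ℝ} (hc : c ≠ 0) (Z U : V) (hU : C.h U = c • U) (hηY : C.η Y = 0) :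
      C.g ((C.R.flip C.ξ).flip Y Z) U = C.g ((0 : V →ₗ[ℝ] V) Z) U := by
    rw [LinearMap.flip_apply, LinearMap.flip_apply, C.g_R_pair, C.g_R_skew, C.R_ξ,
      η_eq_zero hc hU, hηY]
    simp
  have h2 := η_eq_zero hc.1 hY
  rw [ric_apply, trace_eq hc (B := 0) (B' := 0) (fun Z U _ hU ↦ h1 hc.1 Z U hU h2)
    fun Z U _ hU ↦ h1 hc.neg.1 Z U hU h2]
  have h3 : C.R C.ξ C.ξ Y = 0 := by
    have := C.R_swap C.ξ C.ξ Y
    have h4 : (2 : ℝ) • C.R C.ξ C.ξ Y = 0 := by linear_combination (norm := module) this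
    exact (smul_eq_zero.1 h4).resolve_left two_ne_zero
  simp [h3]

/-- On each eigenspace the trace involves only components with three entries in one eigenspace and
one in the other, which vanish; the ξ-term is a multiple of g(X,Y) = 0. -/
theorem ric_of_eigen_neg (hc : C.IsEigenvalue c) {X Y : V} (hX : C.h X = c • X)
    (hY : C.h Y = (-c) • Y) : C.ric X Y = 0 := by
  rw [ric_apply, trace_eq hc (B := 0) (B' := 0)]
  · rw [LinearMap.flip_apply, LinearMap.flip_apply, η_eq, g_R_ξ_left (η_eq_zero hc.1 hX), hX]
    simp [g_eq_zero_of_eigen hc.1 hX hY]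
  · intro Z U hZ hU
    have h1 := g_R_eq_zero hc hZ hX hU hY
    rw [LinearMap.flip_apply, LinearMap.flip_apply, C.g_R_skew, C.g_symm Y, h1]; simp
  · intro Z U hZ hU
    have h1 := g_R_eq_zero hc.neg hY hU hZ (by simpa using hX)
    rw [LinearMap.flip_apply, LinearMap.flip_apply, C.g_R_pair, h1]; simp

/-- In dimension 2n+1 the coefficients of g(X,Y) are κ + μc from ξ, (2ε+2c-εμ)(n-1) from the
c-eigenspace (trace n of the projection, less one for X itself), and -(κ+εμ) from the other
eigenspace, so κ drops out. -/
theorem ric_of_eigen (hc : C.IsEigenvalue c) {X Y : V} (hX : C.h X = c • X)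
    (hY : C.h Y = c • Y) : C.ric X Y = ((2 * C.ε + 2 * c - C.ε * C.μ) *
      (((Module.finrank ℝ V : ℝ) - 1) / 2 - 1) - C.ε * C.μ + C.μ * c) * C.g X Y := by
  rw [ric_apply, trace_eq hc (F := (C.R.flip X).flip Y)
    (B := (2 * C.ε + 2 * c - C.ε * C.μ) • (C.g X Y • LinearMap.id - (C.g Y).smulRight X))
    (B' := -(C.κ • (C.g (C.φ Y)).smulRight (C.φ X) +
      (C.ε * C.μ) • (C.g (C.φ X)).smulRight (C.φ Y)))]
  · have h2 (f : V →ₗ[ℝ] ℝ) (b : V) (c : ℝ) : f.smulRight b ∘ₗ C.proj c =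
      (f ∘ₗ C.proj c).smulRight b := rfl
    rw [LinearMap.flip_apply, LinearMap.flip_apply, η_eq, g_R_ξ_left (η_eq_zero hc.1 hX), hX]
    simp only [LinearMap.smul_comp, LinearMap.sub_comp, LinearMap.add_comp, LinearMap.neg_comp,
      LinearMap.id_comp, h2, map_sub, map_add, map_neg, map_smul, trace_proj,
      LinearMap.trace_smulRight, LinearMap.comp_apply, proj_of_eigen hc hX,
      proj_of_eigen hc.neg (h_φ_of_eigen hX), proj_of_eigen hc.neg (h_φ_of_eigen hY),
      g_φ_φ_of_eigen hc.1 hX, g_φ_φ_of_eigen hc.1 hY, C.g_symm Y X, smul_eq_mul,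
      LinearMap.smul_apply]
    linear_combination (C.κ + C.μ * c) * C.g X Y * C.ε_sq
  · intro Z U hZ hU
    have h1 := g_R_same hc hZ hX hY hU
    rw [LinearMap.flip_apply, LinearMap.flip_apply, h1]
    simp [C.g_symm Y Z]
  · intro Z U hZ hU
    have h1 := g_R_mixed hc hZ hX hY hU
    rw [LinearMap.flip_apply, LinearMap.flip_apply, h1, C.g_φ Z, C.g_symm Z, C.g_symm Z]
    simp; ring

end Ricci

section RicciOperator

variable {V : Type*} [AddCommGroup V] [Module ℝ V] [Module.Finite ℝ V] {C : KappaMuTensor V}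
  {c : ℝ}

/-- The operator Q is a scalar on each eigenspace and multiplies ξ by 2nκ, so both bilinear forms
need only be compared on ξ and on eigenvectors. -/
theorem ric_eq (hc : C.IsEigenvalue c) {n : ℕ} (hn : Module.finrank ℝ V = 2 * n + 1) (X Y : V) :
    C.ric X Y = C.g ((C.ε * (2 * ((n : ℝ) - 1) - n * C.μ)) • X
      + (2 * ((n : ℝ) - 1) + C.μ) • C.h X
      + ((2 * (1 - (n : ℝ)) * C.ε + 2 * n * C.κ + n * C.ε * C.μ) * C.η X) • C.ξ) Y := by
  set Q : V →ₗ[ℝ] V := (C.ε * (2 * ((n : ℝ) - 1) - n * C.μ)) • LinearMap.id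
      + (2 * ((n : ℝ) - 1) + C.μ) • C.h
      + (2 * (1 - (n : ℝ)) * C.ε + 2 * n * C.κ + n * C.ε * C.μ) • C.η.smulRight C.ξ with hQ
  have hn' : (Module.finrank ℝ V : ℝ) = 2 * n + 1 := by rw [hn]; push_cast; ring
  have Q_eigen {c : ℝ} (hc : C.IsEigenvalue c) {X : V} (hX : C.h X = c • X) :
      Q X = (C.ε * (2 * ((n : ℝ) - 1) - n * C.μ) + (2 * ((n : ℝ) - 1) + C.μ) * c) • X := by
    simp only [hQ, LinearMap.add_apply, LinearMap.smul_apply, LinearMap.id_apply,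
      LinearMap.smulRight_apply, hX, η_eq_zero hc.1 hX]
    module
  have Q_ξ : Q C.ξ = (2 * n * C.κ) • C.ξ := by
    simp only [hQ, LinearMap.add_apply, LinearMap.smul_apply, LinearMap.id_apply,
      LinearMap.smulRight_apply, C.h_ξ, C.η_ξ]
    module
  have on_eigen {c : ℝ} (hc : C.IsEigenvalue c) (X : V) (hX : C.h X = c • X) :
      C.ric X = C.g (Q X) := by
    refine ext_eigen hc ?_ (fun Y hY ↦ ?_) fun Y hY ↦ ?_
    · rw [ric_ξ_right, Q_eigen hc hX, C.g_ξ, map_smul, η_eq_zero hc.1 hX]; simp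
    · rw [ric_of_eigen hc hX hY, hn', Q_eigen hc hX, map_smul, LinearMap.smul_apply, smul_eq_mul]
      ring
    · rw [ric_of_eigen_neg hc hX hY, Q_eigen hc hX, map_smul, LinearMap.smul_apply,
        g_eq_zero_of_eigen hc.1 hX hY, smul_zero]
  have key : C.ric = C.g ∘ₗ Q := by
    refine ext_eigen hc ?_ (on_eigen hc) (on_eigen hc.neg)
    rw [LinearMap.comp_apply, Q_ξ, map_smul]
    refine ext_eigen hc ?_ (fun Y hY ↦ ?_) fun Y hY ↦ ?_
    · rw [ric_ξ_right, hn', LinearMap.smul_apply, C.g_ξ, smul_eq_mul]; ring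
    · rw [ric_ξ_left hc hY, LinearMap.smul_apply, C.g_symm, C.g_ξ, η_eq_zero hc.1 hY]; simp
    · rw [ric_ξ_left hc.neg hY, LinearMap.smul_apply, C.g_symm, C.g_ξ, η_eq_zero hc.neg.1 hY]
      simp
  have h1 := congrArg (fun f ↦ f X Y) key
  simp only [LinearMap.comp_apply] at h1
  rw [h1]
  simp only [hQ, LinearMap.add_apply, LinearMap.smul_apply, LinearMap.id_apply,
    LinearMap.smulRight_apply, smul_smul]

end RicciOperator

end KappaMuTensor

noncomputable section

variable {E : Type*} [NormedAddCommGroup E] [NormedSpace ℝ E] [FiniteDimensional ℝ E]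
  [CompleteSpace E] {H : Type*} [TopologicalSpace H] {I : ModelWithCorners ℝ E H}
  {M : Type*} [TopologicalSpace M] [ChartedSpace H M] [IsManifold I ∞ M]

/-! ### Smoothness of brackets, inner products and directional derivatives. -/

section Smoothness

open scoped Topology

theorem contMDiffAt_mlieBracket {X Y : Π x : M, TangentSpace I x} {x : M}
    (hX : CMDiffAt ∞ (T% X) x) (hY : CMDiffAt ∞ (T% Y) x) :
    CMDiffAt ∞ (T% (mlieBracket I X Y)) x := by
  have : IsManifold I (minSmoothness ℝ 2) M := by simpa using inferInstanceAs (IsManifold I 2 M)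
  have : IsManifold I (((⊤ : ℕ∞) : ℕ∞ω) + 1) M := inferInstanceAs (IsManifold I ∞ M)
  exact ContMDiffAt.mlieBracket_vectorField (m := ⊤) (n := ⊤) hX hY (by simp)

theorem contMDiffAt_oneForm_apply {η : Π x : M, TangentSpace I x →L[ℝ] ℝ}
    {X : Π x : M, TangentSpace I x} {x : M}
    (hη : ContMDiffAt I (I.prod 𝓘(ℝ, E →L[ℝ] ℝ)) ∞ (fun x ↦ TotalSpace.mk' (E →L[ℝ] ℝ)
      (E := fun x ↦ TangentSpace I x →L[ℝ] ℝ) x (η x)) x)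
    (hX : CMDiffAt ∞ (T% X) x) : CMDiffAt ∞ (fun y ↦ η y (X y)) x := by
  have : ContMDiffAt I (I.prod 𝓘(ℝ)) ∞
      (fun m ↦ TotalSpace.mk' ℝ (E := Bundle.Trivial M ℝ) m (η m (X m))) x :=
    ContMDiffAt.clm_bundle_apply (F₁ := E) hη hX
  simp only [contMDiffAt_totalSpace] at this
  exact this.2

theorem contMDiffAt_endo_apply {φ : Π x : M, TangentSpace I x →L[ℝ] TangentSpace I x}
    {X : Π x : M, TangentSpace I x} {x : M}
    (hφ : ContMDiffAt I (I.prod 𝓘(ℝ, E →L[ℝ] E)) ∞ (fun x ↦ TotalSpace.mk' (E →L[ℝ] E)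
      (E := fun x ↦ TangentSpace I x →L[ℝ] TangentSpace I x) x (φ x)) x)
    (hX : CMDiffAt ∞ (T% X) x) : CMDiffAt ∞ (T% (fun y ↦ φ y (X y))) x :=
  ContMDiffAt.clm_bundle_apply (F₁ := E) (F₂ := E) hφ hX

namespace PseudoRiemannianMetric

variable (g : PseudoRiemannianMetric I M)

theorem contMDiffAt_val {X Y : Π x : M, TangentSpace I x} {x : M}
    (hX : CMDiffAt ∞ (T% X) x) (hY : CMDiffAt ∞ (T% Y) x) :
    CMDiffAt ∞ (fun y ↦ g.val y (X y) (Y y)) x := by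
  have : ContMDiffAt I (I.prod 𝓘(ℝ)) ∞
      (fun m ↦ TotalSpace.mk' ℝ (E := Bundle.Trivial M ℝ) m (g.val m (X m) (Y m))) x :=
    ContMDiffAt.clm_bundle_apply₂ (F₁ := E) (F₂ := E) g.contMDiff.contMDiffAt hX hY
  simp only [contMDiffAt_totalSpace] at this
  exact this.2

theorem exists_val_ne_zero [Nontrivial E] (x : M) : ∃ u v, g.val x u v ≠ 0 := by
  have : Nontrivial (TangentSpace I x) := inferInstanceAs (Nontrivial E)
  obtain ⟨u, hu⟩ := exists_ne (0 : TangentSpace I x)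
  by_contra! h
  exact hu (g.nondegenerate x u (h u))

end PseudoRiemannianMetric

theorem eventually_mdifferentiableAt {F : Π x : M, TangentSpace I x} {x : M}
    (hF : CMDiffAt ∞ (T% F) x) : ∀ᶠ y in 𝓝 x, MDiffAt (T% F) y := by
  have : CMDiffAt 1 (T% F) x := hF.of_le (by simp)
  filter_upwards [(contMDiffAt_iff_contMDiffAt_nhds (by simp)).1 this] with y hy using hy.mdifferentiableAt (by simp)

/-- From [X,fu] - f[X,u] = (Xf)u, smoothness of the Lie bracket yields smoothness of Xf: pair with v
and divide by g(u,v), which is nonzero near x for suitable u, v. -/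
theorem PseudoRiemannianMetric.contMDiffAt_mvfderiv_apply (g : PseudoRiemannianMetric I M)
    [Nontrivial E] {f : M → ℝ} {X : Π x : M, TangentSpace I x} {x : M}
    (hf : CMDiffAt ∞ f x) (hX : CMDiffAt ∞ (T% X) x) : CMDiffAt ∞ (fun y ↦ d% f y (X y)) x := by
  obtain ⟨u, v, huv⟩ := g.exists_val_ne_zero x
  have hu := contMDiffAt_extend (k := ∞) I E u
  have hv := contMDiffAt_extend (k := ∞) I E v
  have hg := g.contMDiffAt_val hu hv
  have hne : g.val x (extend E u x) (extend E v x) ≠ 0 := by simpa using huv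
  have h1 := (g.contMDiffAt_val (contMDiffAt_mlieBracket hX (hf.smul_section hu)) hv).sub
    (hf.mul (g.contMDiffAt_val (contMDiffAt_mlieBracket hX hu) hv))
  refine (h1.mul (hg.inv₀ hne)).congr_of_eventuallyEq ?_
  have hf' : CMDiffAt 1 f x := hf.of_le (by simp)
  filter_upwards [(contMDiffAt_iff_contMDiffAt_nhds (by simp)).1 hf', eventually_mdifferentiableAt hu,
    hg.continuousAt.eventually_ne hne] with y hy hy2 hy3
  have h2 := mlieBracket_smul_right (V := X) (hy.mdifferentiableAt (by simp)) hy2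
  change _ = (g.val y (mlieBracket I X (f • extend E u) y) (extend E v y) -
    f y * g.val y (mlieBracket I X (extend E u) y) (extend E v y)) * _
  rw [h2]
  simp only [map_add, map_smul, add_apply, smul_apply, smul_eq_mul, add_sub_cancel_right]
  rw [mul_inv_cancel_right₀ hy3]

namespace PseudoRiemannianMetric

variable (g : PseudoRiemannianMetric I M)

theorem contMDiffAt_koszul [Nontrivial E] {X Y Z : Π x : M, TangentSpace I x} {x : M}
    (hX : CMDiffAt ∞ (T% X) x) (hY : CMDiffAt ∞ (T% Y) x) (hZ : CMDiffAt ∞ (T% Z) x) :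
    CMDiffAt ∞ (g.koszul X Y Z) x := by
  refine contMDiffAt_const.mul (((((
    (g.contMDiffAt_mvfderiv_apply (g.contMDiffAt_val hY hZ) hX).add
    (g.contMDiffAt_mvfderiv_apply (g.contMDiffAt_val hZ hX) hY)).sub
    (g.contMDiffAt_mvfderiv_apply (g.contMDiffAt_val hX hY) hZ)).add
    (g.contMDiffAt_val (contMDiffAt_mlieBracket hX hY) hZ)).sub
    (g.contMDiffAt_val (contMDiffAt_mlieBracket hY hZ) hX)).add
    (g.contMDiffAt_val (contMDiffAt_mlieBracket hZ hX) hY))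

end PseudoRiemannianMetric
end Smoothness

/-! ### Smoothness of the Levi-Civita connection. -/

section ConnectionSmoothness

open scoped Topology

namespace PseudoRiemannianMetric

variable (g : PseudoRiemannianMetric I M)

/-- The Gram matrix of `g` in a local frame, as an operator on coordinate vectors. -/
def gram {ι : Type*} [Fintype ι] [DecidableEq ι] (s : ι → Π x : M, TangentSpace I x) (y : M) :
    (ι → ℝ) →L[ℝ] (ι → ℝ) :=
  ∑ i, ∑ j, g.val y (s i y) (s j y) •
    (ContinuousLinearMap.proj (R := ℝ) (φ := fun _ : ι ↦ ℝ) i).smulRight (Pi.single j (1 : ℝ))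

theorem gram_apply {ι : Type*} [Fintype ι] [DecidableEq ι] (s : ι → Π x : M, TangentSpace I x)
    (y : M) (c : ι → ℝ) (j : ι) : g.gram s y c j = g.val y (∑ i, c i • s i y) (s j y) := by
  simp only [gram, FunLike.coe_sum, Finset.sum_apply, smul_apply,
    ContinuousLinearMap.smulRight_apply, ContinuousLinearMap.proj_apply, Pi.smul_apply,
    smul_eq_mul, map_sum, map_smul]
  refine Finset.sum_congr rfl fun i _ ↦ ?_
  rw [Finset.sum_eq_single j (by intro k _ hk; simp [hk.symm]) (by simp)]
  simp [mul_comm]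

theorem contMDiffAt_gram {ι : Type*} [Fintype ι] [DecidableEq ι]
    {s : ι → Π x : M, TangentSpace I x} {x : M} (hs : ∀ i, CMDiffAt ∞ (T% (s i)) x) :
    CMDiffAt ∞ (g.gram s) x := by
  have h : CMDiffAt ∞ (fun y ↦ ∑ i, ∑ j, g.val y (s i y) (s j y) •
    (ContinuousLinearMap.proj (R := ℝ) (φ := fun _ : ι ↦ ℝ) i).smulRight
      (Pi.single (M := fun _ : ι ↦ ℝ) j (1 : ℝ))) x :=
    contMDiffAt_finsetSum fun i _ ↦ contMDiffAt_finsetSum fun j _ ↦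
      (g.contMDiffAt_val (hs i) (hs j)).smul contMDiffAt_const
  exact h

/-- A vector field is smooth if its inner products with smooth vector fields are. -/
theorem contMDiffAt_of_val {V : Π x : M, TangentSpace I x} {x : M}
    (h : ∀ Z : Π x : M, TangentSpace I x, CMDiffAt ∞ (T% Z) x →
      CMDiffAt ∞ (fun y ↦ g.val y (V y) (Z y)) x) : CMDiffAt ∞ (T% V) x := by
  classical
  set e := trivializationAt E (TangentSpace I) x
  have hx : x ∈ e.baseSet := mem_baseSet_trivializationAt' x
  set b := Module.finBasis ℝ E
  have hs i : CMDiffAt ∞ (T% (e.localFrame b i)) x := contMDiffAt_localFrame_of_mem ∞ e b i hx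
  set c : M → Fin (Module.finrank ℝ E) → ℝ := fun y i ↦ e.localFrameCoeff I b i y (V y)
  have hk : ContMDiffAt I 𝓘(ℝ, Fin (Module.finrank ℝ E) → ℝ) ∞ (fun y j ↦ g.val y (V y) (e.localFrame b j y)) x :=
    contMDiffAt_pi_space.2 fun j ↦ h _ (hs j)
  -- A coordinate vector in the kernel represents a tangent vector orthogonal to the whole frame,
  -- hence zero by nondegeneracy.
  have hinj y (hy : y ∈ e.baseSet) : Function.Injective (g.gram (e.localFrame b) y) := by
    rw [injective_iff_map_eq_zero]
    intro d hd
    have h0 : ∑ i, d i • e.localFrame b i y = 0 := by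
      refine g.nondegenerate y _ fun v ↦ ?_
      rw [← (e.basisAt b hy).sum_repr v, map_sum]
      refine Finset.sum_eq_zero fun j _ ↦ ?_
      rw [map_smul, ← e.localFrame_apply_of_mem_baseSet b hy, ← gram_apply, hd]
      simp
    simp only [e.localFrame_apply_of_mem_baseSet b hy] at h0
    exact funext (Fintype.linearIndependent_iff.1 (e.basisAt b hy).linearIndependent d h0)
  set G : ∀ y, y ∈ e.baseSet → ((Fin (Module.finrank ℝ E) → ℝ) ≃L[ℝ] _) := fun y hy ↦
    (LinearEquiv.ofInjectiveEndo (g.gram (e.localFrame b) y).toLinearMap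
      (hinj y hy)).toContinuousLinearEquiv
  have hG y hy : (G y hy : (Fin (Module.finrank ℝ E) → ℝ) →L[ℝ] _) = g.gram (e.localFrame b) y := by
    ext1 v; rfl
  -- Inversion of operators is smooth at an invertible one. The coordinates of V are the inverse
  -- Gram operator applied to the inner products of V with the frame.
  have hinv : CMDiffAt ∞ (fun y ↦ (g.gram (e.localFrame b) y).inverse) x := by
    have h1 := contDiffAt_map_inverse (n := ∞) (G x hx)
    rw [hG x hx] at h1
    exact h1.contMDiffAt.comp x (g.contMDiffAt_gram hs)
  have hc : ContMDiffAt I 𝓘(ℝ, Fin (Module.finrank ℝ E) → ℝ) ∞ c x := by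
    refine (hinv.clm_apply hk).congr_of_eventuallyEq ?_
    filter_upwards [e.open_baseSet.mem_nhds hx] with y hy
    rw [← hG y hy, ContinuousLinearMap.inverse_equiv]
    symm
    rw [ContinuousLinearEquiv.coe_coe, ContinuousLinearEquiv.symm_apply_eq]
    change _ = g.gram (e.localFrame b) y (c y)
    ext j
    rw [gram_apply, ← e.eq_sum_localFrameCoeff_smul (I := I) (b := b) (s := V) hy]
  rw [contMDiffAt_iff_localFrameCoeff b hx]
  exact fun i ↦ contMDiffAt_pi_space.1 hc i

theorem contMDiffAt_leviCivita [Nontrivial E] {X Y : Π x : M, TangentSpace I x} {x : M}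
    (hX : CMDiffAt ∞ (T% X) x) (hY : CMDiffAt ∞ (T% Y) x) :
    CMDiffAt ∞ (T% (fun y ↦ g.leviCivita Y y (X y))) x := by
  refine g.contMDiffAt_of_val fun Z hZ ↦ ?_
  refine (g.contMDiffAt_koszul hX hY hZ).congr_of_eventuallyEq ?_
  filter_upwards [eventually_mdifferentiableAt hX, eventually_mdifferentiableAt hY,
    eventually_mdifferentiableAt hZ] with y h1 h2 h3
  exact g.val_leviCivitaFun h1 h2 h3

end PseudoRiemannianMetric

end ConnectionSmoothness

/-! ### The ring of smooth functions and the module of smooth fields on a subset. -/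

section Sections

open scoped Topology

theorem mvfderiv_congr_of_eventuallyEq {f f' : M → ℝ} {x : M} (h : f =ᶠ[𝓝 x] f') :
    d% f x = d% f' x := by
  ext1 v
  exact congrArg (fun L : TangentSpace I x →L[ℝ] ℝ ↦ L v) h.mfderiv_eq

variable (I) in
/-- The algebra of smooth functions on `U`. -/
def smoothFun (U : Set M) : Subalgebra ℝ (U → ℝ) where
  carrier := {f | ∃ F : M → ℝ, (∀ y ∈ U, CMDiffAt ∞ F y) ∧ ∀ y : U, f y = F y}
  mul_mem' := by
    rintro a b ⟨F, hF, ha⟩ ⟨G, hG, hb⟩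
    exact ⟨F * G, fun y hy ↦ (hF y hy).mul (hG y hy), fun y ↦ by simp [ha, hb]⟩
  add_mem' := by
    rintro a b ⟨F, hF, ha⟩ ⟨G, hG, hb⟩
    exact ⟨F + G, fun y hy ↦ (hF y hy).add (hG y hy), fun y ↦ by simp [ha, hb]⟩
  algebraMap_mem' r := ⟨fun _ ↦ r, fun y _ ↦ contMDiffAt_const, fun y ↦ rfl⟩

variable (I) in
/-- The module of smooth vector fields on `U`. -/
def smoothField (U : Set M) : Submodule (smoothFun I U) (Π y : U, TangentSpace I (y : M)) where
  carrier := {X | ∃ F : Π y : M, TangentSpace I y, (∀ y ∈ U, CMDiffAt ∞ (T% F) y) ∧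
    ∀ y : U, X y = F y}
  add_mem' := by
    rintro a b ⟨F, hF, ha⟩ ⟨G, hG, hb⟩
    exact ⟨F + G, fun y hy ↦ (hF y hy).add_section (hG y hy), fun y ↦ by simp [ha, hb]⟩
  zero_mem' := ⟨0, fun y _ ↦ contMDiff_zeroSection ℝ _ y, fun y ↦ rfl⟩
  smul_mem' := by
    intro f b ⟨G, hG, hb⟩
    obtain ⟨F, hF, ha⟩ := f.2
    refine ⟨F • G, fun y hy ↦ (hF y hy).smul_section (hG y hy), fun y ↦ ?_⟩
    change f.1 y • b y = F y • G y
    rw [ha, hb]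

variable (I) in
/-- The type of smooth functions on `U`. -/
def SmoothFun (U : Set M) : Type _ := smoothFun I U

variable (I) in
/-- The type of smooth vector fields on `U`. -/
def SmoothField (U : Set M) : Type _ := smoothField I U

instance (U : Set M) : CommRing (SmoothFun I U) := inferInstanceAs (CommRing (smoothFun I U))

instance (U : Set M) : Algebra ℝ (SmoothFun I U) := inferInstanceAs (Algebra ℝ (smoothFun I U))

instance (U : Set M) : AddCommGroup (SmoothField I U) :=
  inferInstanceAs (AddCommGroup (smoothField I U))

instance (U : Set M) : Module (SmoothFun I U) (SmoothField I U) :=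
  inferInstanceAs (Module (smoothFun I U) (smoothField I U))

namespace SmoothFun

variable {U : Set M}

/-- The restriction to `U` of a function that is smooth at the points of `U`. -/
def of (F : M → ℝ) (hF : ∀ y ∈ U, CMDiffAt ∞ F y) : SmoothFun I U :=
  ⟨fun y ↦ F y, F, hF, fun _ ↦ rfl⟩

/-- A function on `M` restricting to `f`. -/
def lift (f : SmoothFun I U) : M → ℝ := f.2.choose

theorem contMDiffAt_lift (f : SmoothFun I U) {y : M} (hy : y ∈ U) : CMDiffAt ∞ f.lift y :=
  f.2.choose_spec.1 y hy

theorem lift_apply (f : SmoothFun I U) (y : U) : f.lift y = f.1 y := (f.2.choose_spec.2 y).symm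

theorem exists_of (f : SmoothFun I U) : ∃ F hF, f = of F hF :=
  ⟨f.lift, fun _ ↦ f.contMDiffAt_lift, Subtype.ext (funext fun y ↦ (f.lift_apply y).symm)⟩

/-- `lift` is a choice, undetermined off U. For U open its germ at each point of U is determined,
and derivatives see nothing more. -/
theorem eventuallyEq_lift (hU : IsOpen U) {F : M → ℝ} (hF : ∀ y ∈ U, CMDiffAt ∞ F y)
    {y : M} (hy : y ∈ U) : (of (I := I) F hF).lift =ᶠ[𝓝 y] F := by
  filter_upwards [hU.mem_nhds hy] with z hz using (of (I := I) F hF).lift_apply ⟨z, hz⟩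

@[ext] theorem ext {f f' : SmoothFun I U} (h : ∀ y, f.1 y = f'.1 y) : f = f' :=
  Subtype.ext (funext h)

@[simp] theorem of_apply (F : M → ℝ) (hF : ∀ y ∈ U, CMDiffAt ∞ F y) (y : U) :
    (of (I := I) F hF).1 y = F y := rfl

@[simp] theorem add_apply (f f' : SmoothFun I U) (y : U) : (f + f').1 y = f.1 y + f'.1 y := rfl

@[simp] theorem mul_apply (f f' : SmoothFun I U) (y : U) : (f * f').1 y = f.1 y * f'.1 y := rfl

@[simp] theorem neg_apply (f : SmoothFun I U) (y : U) : (-f).1 y = -f.1 y := rfl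

@[simp] theorem sub_apply (f f' : SmoothFun I U) (y : U) : (f - f').1 y = f.1 y - f'.1 y := rfl

@[simp] theorem zero_apply (y : U) : (0 : SmoothFun I U).1 y = 0 := rfl

@[simp] theorem one_apply (y : U) : (1 : SmoothFun I U).1 y = 1 := rfl

@[simp] theorem algebraMap_apply (r : ℝ) (y : U) :
    (algebraMap ℝ (SmoothFun I U) r).1 y = r := rfl

end SmoothFun

namespace SmoothField

variable {U : Set M}

/-- The restriction to `U` of a vector field that is smooth at the points of `U`. -/
def of (F : Π y : M, TangentSpace I y) (hF : ∀ y ∈ U, CMDiffAt ∞ (T% F) y) : SmoothField I U :=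
  ⟨fun y ↦ F y, F, hF, fun _ ↦ rfl⟩

/-- A vector field on `M` restricting to `X`. -/
def lift (X : SmoothField I U) : Π y : M, TangentSpace I y := X.2.choose

theorem contMDiffAt_lift (X : SmoothField I U) {y : M} (hy : y ∈ U) :
    CMDiffAt ∞ (T% X.lift) y := X.2.choose_spec.1 y hy

theorem lift_apply (X : SmoothField I U) (y : U) : X.lift y = X.1 y :=
  (X.2.choose_spec.2 y).symm

theorem exists_of (X : SmoothField I U) : ∃ F hF, X = of F hF :=
  ⟨X.lift, fun _ ↦ X.contMDiffAt_lift, Subtype.ext (funext fun y ↦ (X.lift_apply y).symm)⟩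

theorem eventually_lift_eq (hU : IsOpen U) {F : Π y : M, TangentSpace I y}
    (hF : ∀ y ∈ U, CMDiffAt ∞ (T% F) y) {y : M} (hy : y ∈ U) :
    ∀ᶠ z in 𝓝 y, (of F hF).lift z = F z := by
  filter_upwards [hU.mem_nhds hy] with z hz using (of F hF).lift_apply ⟨z, hz⟩

@[ext] theorem ext {X Y : SmoothField I U} (h : ∀ y, X.1 y = Y.1 y) : X = Y :=
  Subtype.ext (funext h)

@[simp] theorem of_apply (F : Π y : M, TangentSpace I y) (hF : ∀ y ∈ U, CMDiffAt ∞ (T% F) y)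
    (y : U) : (of F hF).1 y = F y := rfl

@[simp] theorem add_apply (X Y : SmoothField I U) (y : U) : (X + Y).1 y = X.1 y + Y.1 y := rfl

@[simp] theorem neg_apply (X : SmoothField I U) (y : U) : (-X).1 y = -X.1 y := rfl

@[simp] theorem sub_apply (X Y : SmoothField I U) (y : U) : (X - Y).1 y = X.1 y - Y.1 y := rfl

@[simp] theorem zero_apply (y : U) : (0 : SmoothField I U).1 y = 0 := rfl

@[simp] theorem smul_apply (f : SmoothFun I U) (X : SmoothField I U) (y : U) :
    (f • X).1 y = f.1 y • X.1 y := rfl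

/-- Evaluation at a point. -/
def eval (y : U) : SmoothField I U →+ TangentSpace I (y : M) where
  toFun X := X.1 y
  map_zero' := rfl
  map_add' _ _ := rfl

theorem mdifferentiableAt {F : Π y : M, TangentSpace I y} {y : M}
    (hF : CMDiffAt ∞ (T% F) y) : MDiffAt (T% F) y := hF.mdifferentiableAt (by simp)

/-- On a set contained in the domain of a trivialization, smooth vector fields take all values. -/
theorem exists_apply_eq {x₀ : M} (hU : U ⊆ (trivializationAt E (TangentSpace I) x₀).baseSet)
    (y : U) (v : TangentSpace I (y : M)) : ∃ X : SmoothField I U, X.1 y = v := by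
  set e := trivializationAt E (TangentSpace I) x₀
  set b := Module.finBasis ℝ E
  have hs i z (hz : z ∈ U) : CMDiffAt ∞ (T% (e.localFrame b i)) z :=
    contMDiffAt_localFrame_of_mem ∞ e b i (hU hz)
  refine ⟨∑ i, algebraMap ℝ (SmoothFun I U) ((e.basisAt b (hU y.2)).repr v i) •
    of (e.localFrame b i) (hs i), ?_⟩
  change eval y _ = v
  rw [map_sum]
  conv_rhs => rw [← (e.basisAt b (hU y.2)).sum_repr v]
  refine Finset.sum_congr rfl fun i _ ↦ ?_
  rw [← e.localFrame_apply_of_mem_baseSet b]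
  rfl

end SmoothField

end Sections

/-! ### Smooth fields on a trivializing open set as a model of the algebraic calculus. -/

section LocalCalculus

namespace PseudoRiemannianMetric

variable (g : PseudoRiemannianMetric I M) {U : Set M}

theorem leviCivita_congr {Y Y' : Π x : M, TangentSpace I x} {x : M} (hY : MDiffAt (T% Y) x)
    (hY' : MDiffAt (T% Y') x) (h : ∀ᶠ y in nhds x, Y y = Y' y) :
    g.leviCivita Y x = g.leviCivita Y' x :=
  g.leviCivita.isCovariantDerivativeOn.congr_of_eventuallyEq (s := Set.univ) hY hY'
    Filter.univ_mem h

/-- The inner product of vector fields on `U`. -/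
def fieldInner (X Y : SmoothField I U) : SmoothFun I U :=
  .of (fun y ↦ g.val y (X.lift y) (Y.lift y))
    fun _ hy ↦ g.contMDiffAt_val (X.contMDiffAt_lift hy) (Y.contMDiffAt_lift hy)

theorem fieldInner_apply (X Y : SmoothField I U) (y : U) :
    (g.fieldInner X Y).1 y = g.val y (X.1 y) (Y.1 y) := by
  rw [← X.lift_apply, ← Y.lift_apply]; rfl

variable [Nontrivial E]

/-- The derivative of a function on `U` along a vector field. -/
def fieldDeriv (X : SmoothField I U) (f : SmoothFun I U) : SmoothFun I U :=
  .of (fun y ↦ d% f.lift y (X.lift y))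
    fun _ hy ↦ g.contMDiffAt_mvfderiv_apply (f.contMDiffAt_lift hy) (X.contMDiffAt_lift hy)

theorem fieldDeriv_of_apply (hU : IsOpen U) (X : SmoothField I U) {F : M → ℝ}
    (hF : ∀ y ∈ U, CMDiffAt ∞ F y) (y : U) :
    (g.fieldDeriv X (.of F hF)).1 y = d% F (y : M) (X.1 y) := by
  rw [← X.lift_apply, ← mvfderiv_congr_of_eventuallyEq (SmoothFun.eventuallyEq_lift hU hF y.2)]
  rfl

/-- The Levi-Civita connection on vector fields on `U`. -/
def fieldConn (X Y : SmoothField I U) : SmoothField I U :=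
  .of (fun y ↦ g.leviCivita Y.lift y (X.lift y))
    fun _ hy ↦ g.contMDiffAt_leviCivita (X.contMDiffAt_lift hy) (Y.contMDiffAt_lift hy)

theorem fieldConn_of_apply (hU : IsOpen U) (X : SmoothField I U) {F : Π y : M, TangentSpace I y}
    (hF : ∀ y ∈ U, CMDiffAt ∞ (T% F) y) (y : U) :
    (g.fieldConn X (.of F hF)).1 y = g.leviCivita F y (X.1 y) := by
  rw [← X.lift_apply, ← g.leviCivita_congr ((SmoothField.of F hF).contMDiffAt_lift y.2
    |> SmoothField.mdifferentiableAt) (SmoothField.mdifferentiableAt (hF y y.2))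
    (SmoothField.eventually_lift_eq hU hF y.2)]
  rfl

theorem fieldConn_of_of (hU : IsOpen U) {F G : Π y : M, TangentSpace I y}
    (hF : ∀ y ∈ U, CMDiffAt ∞ (T% F) y) (hG : ∀ y ∈ U, CMDiffAt ∞ (T% G) y) :
    g.fieldConn (.of F hF) (.of G hG) = .of (fun y ↦ g.leviCivita G y (F y))
      fun y hy ↦ g.contMDiffAt_leviCivita (hF y hy) (hG y hy) := by
  ext y
  rw [g.fieldConn_of_apply hU]; rfl

theorem fieldConn_sub_fieldConn (hU : IsOpen U) {F G : Π y : M, TangentSpace I y}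
    (hF : ∀ y ∈ U, CMDiffAt ∞ (T% F) y) (hG : ∀ y ∈ U, CMDiffAt ∞ (T% G) y) :
    g.fieldConn (.of F hF) (.of G hG) - g.fieldConn (.of G hG) (.of F hF) =
      .of (mlieBracket I F G) fun y hy ↦ contMDiffAt_mlieBracket (hF y hy) (hG y hy) := by
  ext y
  rw [SmoothField.sub_apply, g.fieldConn_of_apply hU, g.fieldConn_of_apply hU]
  exact (CovariantDerivative.torsion_eq_zero_iff _).1 g.torsion_leviCivita
    (SmoothField.mdifferentiableAt (hF y y.2)) (SmoothField.mdifferentiableAt (hG y y.2))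

/-- The derivative along a vector field, as a derivation. -/
def fieldDerivation (hU : IsOpen U) (X : SmoothField I U) :
    Derivation ℝ (SmoothFun I U) (SmoothFun I U) :=
  Derivation.mk'
    { toFun := g.fieldDeriv X
      map_add' := fun f f' ↦ by
        obtain ⟨F, hF, rfl⟩ := f.exists_of
        obtain ⟨F', hF', rfl⟩ := f'.exists_of
        ext y
        have h : SmoothFun.of (I := I) F hF + .of F' hF' =
          .of (F + F') fun y hy ↦ (hF y hy).add (hF' y hy) := rfl
        rw [h, SmoothFun.add_apply]
        simp only [g.fieldDeriv_of_apply hU]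
        rw [mvfderiv_add ((hF y y.2).mdifferentiableAt (by simp))
          ((hF' y y.2).mdifferentiableAt (by simp))]
        rfl
      map_smul' := fun r f ↦ by
        obtain ⟨F, hF, rfl⟩ := f.exists_of
        ext y
        have h : r • SmoothFun.of (I := I) F hF =
          .of ((fun _ ↦ r) * F) fun y hy ↦ contMDiffAt_const.mul (hF y hy) := rfl
        rw [h]
        change _ = r * (g.fieldDeriv X (.of F hF)).1 y
        simp only [g.fieldDeriv_of_apply hU]
        rw [mvfderiv_mul mdifferentiableAt_const ((hF y y.2).mdifferentiableAt (by simp)),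
          mvfderiv_const]
        simp }
    fun f f' ↦ by
      obtain ⟨F, hF, rfl⟩ := f.exists_of
      obtain ⟨F', hF', rfl⟩ := f'.exists_of
      ext y
      have h : SmoothFun.of (I := I) F hF * .of F' hF' =
        .of (F * F') fun y hy ↦ (hF y hy).mul (hF' y hy) := rfl
      simp only [LinearMap.coe_mk, AddHom.coe_mk, h, smul_eq_mul, SmoothFun.add_apply,
        SmoothFun.mul_apply]
      simp only [g.fieldDeriv_of_apply hU]
      rw [mvfderiv_mul ((hF y y.2).mdifferentiableAt (by simp))
          ((hF' y y.2).mdifferentiableAt (by simp))]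
      rfl

/-- The derivative as a linear map into derivations. -/
def fieldDerivationHom (hU : IsOpen U) :
    SmoothField I U →ₗ[SmoothFun I U] Derivation ℝ (SmoothFun I U) (SmoothFun I U) where
  toFun := g.fieldDerivation hU
  map_add' X Y := by
    refine Derivation.ext fun f ↦ SmoothFun.ext fun y ↦ ?_
    obtain ⟨F, hF, rfl⟩ := f.exists_of
    change (g.fieldDeriv (X + Y) (.of F hF)).1 y =
      (g.fieldDeriv X (.of F hF)).1 y + (g.fieldDeriv Y (.of F hF)).1 y
    simp only [g.fieldDeriv_of_apply hU]
    exact map_add _ _ _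
  map_smul' f X := by
    refine Derivation.ext fun f' ↦ SmoothFun.ext fun y ↦ ?_
    obtain ⟨F, hF, rfl⟩ := f'.exists_of
    change (g.fieldDeriv (f • X) (.of F hF)).1 y = f.1 y * (g.fieldDeriv X (.of F hF)).1 y
    simp only [g.fieldDeriv_of_apply hU]
    exact map_smul _ _ _

/-- The Levi-Civita connection as a linear map into additive maps. -/
def fieldConnHom (hU : IsOpen U) :
    SmoothField I U →ₗ[SmoothFun I U] SmoothField I U →+ SmoothField I U :=
  { toFun := fun X ↦ AddMonoidHom.mk' (g.fieldConn X) fun Y Z ↦ by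
      obtain ⟨F, hF, rfl⟩ := Y.exists_of
      obtain ⟨F', hF', rfl⟩ := Z.exists_of
      ext y
      have h : SmoothField.of (I := I) F hF + .of F' hF' =
        .of (F + F') fun y hy ↦ (hF y hy).add_section (hF' y hy) := rfl
      rw [h, SmoothField.add_apply]
      simp only [g.fieldConn_of_apply hU]
      rw [g.leviCivita.isCovariantDerivativeOn.add
        (SmoothField.mdifferentiableAt (hF y y.2)) (SmoothField.mdifferentiableAt (hF' y y.2))]
      rfl
    map_add' := fun X Y ↦ by
      ext1 Z
      obtain ⟨F, hF, rfl⟩ := Z.exists_of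
      refine SmoothField.ext fun y ↦ ?_
      change (g.fieldConn (X + Y) (.of F hF)).1 y =
        (g.fieldConn X (.of F hF)).1 y + (g.fieldConn Y (.of F hF)).1 y
      simp only [g.fieldConn_of_apply hU]
      exact map_add _ _ _
    map_smul' := fun f X ↦ by
      ext1 Z
      obtain ⟨F, hF, rfl⟩ := Z.exists_of
      refine SmoothField.ext fun y ↦ ?_
      change (g.fieldConn (f • X) (.of F hF)).1 y = f.1 y • (g.fieldConn X (.of F hF)).1 y
      simp only [g.fieldConn_of_apply hU]
      exact map_smul _ _ _ }

/-- The calculus of smooth functions and vector fields on a trivializing open set. -/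
def calculus (hU : IsOpen U) {x₀ : M}
    (hx₀ : U ⊆ (trivializationAt E (TangentSpace I) x₀).baseSet) :
    MetricCalculus (SmoothFun I U) (SmoothField I U) where
  D := g.fieldDerivationHom hU
  nab := g.fieldConnHom hU
  g := LinearMap.mk₂ _ g.fieldInner
    (fun X X' Y ↦ by ext y; simp [fieldInner_apply])
    (fun f X Y ↦ by ext y; simp [fieldInner_apply])
    (fun X Y Y' ↦ by ext y; simp [fieldInner_apply])
    (fun f X Y ↦ by ext y; simp [fieldInner_apply])
  nab_smul X f Y := by
    obtain ⟨F, hF, rfl⟩ := f.exists_of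
    obtain ⟨G, hG, rfl⟩ := Y.exists_of
    ext y
    change (g.fieldConn X (.of (F • G) fun y hy ↦ (hF y hy).smul_section (hG y hy))).1 y =
      F y • (g.fieldConn X (.of G hG)).1 y + (g.fieldDeriv X (.of F hF)).1 y • G y
    simp only [g.fieldConn_of_apply hU, g.fieldDeriv_of_apply hU]
    rw [g.leviCivita.isCovariantDerivativeOn.leibniz
      (SmoothField.mdifferentiableAt (hG y y.2)) ((hF y y.2).mdifferentiableAt (by simp))]
    rfl
  jacobi X Y Z := by
    obtain ⟨F, hF, rfl⟩ := X.exists_of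
    obtain ⟨G, hG, rfl⟩ := Y.exists_of
    obtain ⟨K, hK, rfl⟩ := Z.exists_of
    change g.fieldConn (.of F hF) (g.fieldConn (.of G hG) (.of K hK) -
        g.fieldConn (.of K hK) (.of G hG)) - g.fieldConn (g.fieldConn (.of G hG) (.of K hK) -
        g.fieldConn (.of K hK) (.of G hG)) (.of F hF) =
      (g.fieldConn (g.fieldConn (.of F hF) (.of G hG) - g.fieldConn (.of G hG) (.of F hF))
        (.of K hK) - g.fieldConn (.of K hK) (g.fieldConn (.of F hF) (.of G hG) -
        g.fieldConn (.of G hG) (.of F hF))) +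
      (g.fieldConn (.of G hG) (g.fieldConn (.of F hF) (.of K hK) -
        g.fieldConn (.of K hK) (.of F hF)) - g.fieldConn (g.fieldConn (.of F hF) (.of K hK) -
        g.fieldConn (.of K hK) (.of F hF)) (.of G hG))
    -- Vanishing torsion turns each alternation of the connection into a Lie bracket of fields,
    -- which leaves the Jacobi identity.
    simp only [g.fieldConn_sub_fieldConn hU]
    ext y
    have : IsManifold I (minSmoothness ℝ 3) M := by simpa using inferInstanceAs (IsManifold I 3 M)
    have h2 : minSmoothness ℝ 2 ≤ ∞ := by
      rw [minSmoothness_of_isRCLikeNormedField]; exact WithTop.coe_le_coe.2 le_top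
    exact leibniz_identity_mlieBracket_apply ((hF y y.2).of_le h2)
      ((hG y y.2).of_le h2) ((hK y y.2).of_le h2)
  g_symm X Y := by
    ext y
    change (g.fieldInner X Y).1 y = (g.fieldInner Y X).1 y
    rw [fieldInner_apply, fieldInner_apply, g.symm]
  g_nondeg X h := by
    ext y
    refine g.nondegenerate y _ fun v ↦ ?_
    obtain ⟨V, rfl⟩ := SmoothField.exists_apply_eq hx₀ y v
    rw [← fieldInner_apply]
    exact congrFun (congrArg Subtype.val (h V)) y
  metric X Y Z := by
    obtain ⟨F, hF, rfl⟩ := X.exists_of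
    obtain ⟨G, hG, rfl⟩ := Y.exists_of
    obtain ⟨K, hK, rfl⟩ := Z.exists_of
    ext y
    have h : g.fieldInner (.of G hG) (.of K hK) = .of (fun y ↦ g.val y (G y) (K y))
        fun y hy ↦ g.contMDiffAt_val (hG y hy) (hK y hy) := by
      ext y; rw [fieldInner_apply]; rfl
    change (g.fieldDeriv _ (g.fieldInner (.of G hG) (.of K hK))).1 y =
      (g.fieldInner (g.fieldConn (.of F hF) (.of G hG)) (.of K hK)).1 y +
      (g.fieldInner (.of G hG) (g.fieldConn (.of F hF) (.of K hK))).1 y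
    rw [h, g.fieldDeriv_of_apply hU, fieldInner_apply, fieldInner_apply, g.fieldConn_of_apply hU,
      g.fieldConn_of_apply hU]
    exact g.leviCivita_metric (SmoothField.mdifferentiableAt (hF y y.2))
      (SmoothField.mdifferentiableAt (hG y y.2)) (SmoothField.mdifferentiableAt (hK y y.2))
  faithful a h := by
    ext y
    have : Nontrivial (TangentSpace I (y : M)) := inferInstanceAs (Nontrivial E)
    obtain ⟨v, hv⟩ := exists_ne (0 : TangentSpace I (y : M))
    obtain ⟨V, rfl⟩ := SmoothField.exists_apply_eq hx₀ y v
    have h2 : a.1 y • V.1 y = 0 := congrFun (congrArg Subtype.val (h V)) y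
    exact (smul_eq_zero.1 h2).resolve_right hv

end PseudoRiemannianMetric

end LocalCalculus

/-! ### Tensoriality: passing from fields to values at a point. -/

section Tensoriality

open scoped Topology

/-- `extend` is constant in the trivialization at x, hence smooth on the entire base set, so it is
an element of the module of fields there. -/
theorem contMDiffAt_extend_of_mem {x y : M} (v : TangentSpace I x)
    (hy : y ∈ (trivializationAt E (TangentSpace I) x).baseSet) :
    CMDiffAt ∞ (T% (extend E v)) y := by
  set t := trivializationAt E (TangentSpace I) x
  rw [t.contMDiffAt_section_iff hy]
  have h : CMDiffAt ∞ (fun _ : M ↦ (t ⟨x, v⟩).2) y := contMDiffAt_const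
  refine h.congr_of_eventuallyEq ?_
  filter_upwards [t.open_baseSet.mem_nhds hy] with z hz
  have := congrArg Prod.snd (t.apply_mk_symm hz (t ⟨x, v⟩).2)
  exact this

variable {U : Set M}

/-- Linear maps of modules of vector fields on trivializing sets act pointwise. -/
theorem SmoothField.map_apply_eq_zero {x₀ : M}
    (hU : U ⊆ (trivializationAt E (TangentSpace I) x₀).baseSet)
    (L : SmoothField I U →ₗ[SmoothFun I U] SmoothField I U) (X : SmoothField I U) (y : U)
    (h : X.1 y = 0) : (L X).1 y = 0 := by
  set e := trivializationAt E (TangentSpace I) x₀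
  set b := Module.finBasis ℝ E
  obtain ⟨F, hF, rfl⟩ := X.exists_of
  have hs i z (hz : z ∈ U) : CMDiffAt ∞ (T% (e.localFrame b i)) z :=
    contMDiffAt_localFrame_of_mem ∞ e b i (hU hz)
  have hc i z (hz : z ∈ U) : CMDiffAt ∞ (fun w ↦ e.localFrameCoeff I b i w (F w)) z :=
    contMDiffAt_localFrameCoeff b (hU hz) (hF z hz) i
  -- Expansion in the local frame: L is linear over the functions, so the coefficients, which vanish
  -- at y, come out.
  have hX : SmoothField.of F hF = ∑ i, SmoothFun.of (I := I) _ (hc i) • of _ (hs i) := by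
    ext z
    change F z = eval z _
    rw [map_sum, e.eq_sum_localFrameCoeff_smul (I := I) (b := b) (s := F) (hU z.2)]
    rfl
  change eval y _ = 0
  rw [hX, map_sum, map_sum]
  refine Finset.sum_eq_zero fun i _ ↦ ?_
  have h2 : F y = 0 := h
  rw [map_smul]
  change (e.localFrameCoeff I b i y (F y)) • (L (SmoothField.of _ (hs i))).1 y = 0
  rw [h2, map_zero, zero_smul]

theorem SmoothField.map_apply_congr {x₀ : M}
    (hU : U ⊆ (trivializationAt E (TangentSpace I) x₀).baseSet)
    (L : SmoothField I U →ₗ[SmoothFun I U] SmoothField I U) {X Y : SmoothField I U} {y : U}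
    (h : X.1 y = Y.1 y) : (L X).1 y = (L Y).1 y := by
  have := SmoothField.map_apply_eq_zero hU L (X - Y) y (by simp [h])
  rw [map_sub, SmoothField.sub_apply] at this
  exact sub_eq_zero.1 this

namespace PseudoRiemannianMetric

variable (g : PseudoRiemannianMetric I M) [Nontrivial E] (hU : IsOpen U) {x₀ : M}
    (hx₀ : U ⊆ (trivializationAt E (TangentSpace I) x₀).baseSet)

theorem calculus_R_of_apply {F G K : Π y : M, TangentSpace I y}
    (hF : ∀ y ∈ U, CMDiffAt ∞ (T% F) y) (hG : ∀ y ∈ U, CMDiffAt ∞ (T% G) y)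
    (hK : ∀ y ∈ U, CMDiffAt ∞ (T% K) y) (y : U) :
    ((g.calculus hU hx₀).R (.of F hF) (.of G hG) (.of K hK)).1 y = g.curvatureField F G K y := by
  change (g.fieldConn (.of F hF) (g.fieldConn (.of G hG) (.of K hK)) -
    g.fieldConn (.of G hG) (g.fieldConn (.of F hF) (.of K hK)) -
    g.fieldConn (g.fieldConn (.of F hF) (.of G hG) - g.fieldConn (.of G hG) (.of F hF))
      (.of K hK)).1 y = _
  rw [g.fieldConn_sub_fieldConn hU]
  simp only [g.fieldConn_of_of hU]
  rfl

theorem calculus_R_apply_congr {X X' Y Y' Z Z' : SmoothField I U} {y : U} (hX : X.1 y = X'.1 y)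
    (hY : Y.1 y = Y'.1 y) (hZ : Z.1 y = Z'.1 y) :
    ((g.calculus hU hx₀).R X Y Z).1 y = ((g.calculus hU hx₀).R X' Y' Z').1 y := by
  rw [SmoothField.map_apply_congr hx₀ _ hZ]
  have h1 := SmoothField.map_apply_congr hx₀ (((g.calculus hU hx₀).R X).flip Z') hY
  have h2 := SmoothField.map_apply_congr hx₀ (((g.calculus hU hx₀).R.flip Y').flip Z') hX
  exact h1.trans h2

/-- Independence of the chosen extensions: on U intersected with the trivializing set at y, both
sides are values of the function-trilinear R of the calculus on fields that agree at y. -/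
theorem curvatureField_eq {y : M} (hU : IsOpen U) (hy : y ∈ U) {F G K : Π y : M, TangentSpace I y}
    (hF : ∀ y ∈ U, CMDiffAt ∞ (T% F) y) (hG : ∀ y ∈ U, CMDiffAt ∞ (T% G) y)
    (hK : ∀ y ∈ U, CMDiffAt ∞ (T% K) y) :
    g.curvatureField F G K y = g.curvature y (F y) (G y) (K y) := by
  set e := trivializationAt E (TangentSpace I) y
  have hy' : y ∈ U ∩ e.baseSet := ⟨hy, mem_baseSet_trivializationAt' y⟩
  have hV : IsOpen (U ∩ e.baseSet) := hU.inter e.open_baseSet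
  have he (v : TangentSpace I y) (z) (hz : z ∈ U ∩ e.baseSet) := contMDiffAt_extend_of_mem v hz.2
  rw [curvature, ← g.calculus_R_of_apply hV Set.inter_subset_right (fun z hz ↦ hF z hz.1)
    (fun z hz ↦ hG z hz.1) (fun z hz ↦ hK z hz.1) ⟨y, hy'⟩,
    ← g.calculus_R_of_apply hV Set.inter_subset_right (he (F y)) (he (G y)) (he (K y)) ⟨y, hy'⟩]
  apply calculus_R_apply_congr <;> simp

theorem calculus_R_apply (X Y Z : SmoothField I U) (y : U) :
    ((g.calculus hU hx₀).R X Y Z).1 y = g.curvature y (X.1 y) (Y.1 y) (Z.1 y) := by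
  obtain ⟨F, hF, rfl⟩ := X.exists_of
  obtain ⟨G, hG, rfl⟩ := Y.exists_of
  obtain ⟨K, hK, rfl⟩ := Z.exists_of
  rw [calculus_R_of_apply, g.curvatureField_eq hU y.2 hF hG hK]
  rfl

theorem curvature_add_left (x : M) (u u' v w : TangentSpace I x) :
    g.curvature x (u + u') v w = g.curvature x u v w + g.curvature x u' v w := by
  have hx := mem_baseSet_trivializationAt E (TangentSpace I : M → Type _) x
  have hU := (trivializationAt E (TangentSpace I : M → Type _) x).open_baseSet
  have ev := SmoothField.exists_apply_eq (I := I) (x₀ := x) subset_rfl ⟨x, hx⟩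
  have hR := fun X Y Z ↦ g.calculus_R_apply hU subset_rfl X Y Z ⟨x, hx⟩
  generalize (g.calculus hU subset_rfl).R = R at hR
  obtain ⟨X, rfl⟩ := ev u
  obtain ⟨X', rfl⟩ := ev u'
  obtain ⟨Y, rfl⟩ := ev v
  obtain ⟨Z, rfl⟩ := ev w
  have h : R (X + X') Y Z = R X Y Z + R X' Y Z := by
    rw [map_add, LinearMap.add_apply, LinearMap.add_apply]
  have h2 := congrArg (fun V ↦ V.1 ⟨x, hx⟩) h
  simpa only [SmoothField.add_apply, hR] using h2

theorem curvature_smul_left (x : M) (c : ℝ) (u v w : TangentSpace I x) :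
    g.curvature x (c • u) v w = c • g.curvature x u v w := by
  have hx := mem_baseSet_trivializationAt E (TangentSpace I : M → Type _) x
  have hU := (trivializationAt E (TangentSpace I : M → Type _) x).open_baseSet
  have ev := SmoothField.exists_apply_eq (I := I) (x₀ := x) subset_rfl ⟨x, hx⟩
  have hR := fun X Y Z ↦ g.calculus_R_apply hU subset_rfl X Y Z ⟨x, hx⟩
  generalize (g.calculus hU subset_rfl).R = R at hR
  obtain ⟨X, rfl⟩ := ev u
  obtain ⟨Y, rfl⟩ := ev v
  obtain ⟨Z, rfl⟩ := ev w
  have h : R (algebraMap ℝ (SmoothFun I (trivializationAt E (TangentSpace I : M → Type _) x).baseSet) c • X) Y Z =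
      (algebraMap ℝ (SmoothFun I (trivializationAt E (TangentSpace I : M → Type _) x).baseSet) c) •
        R X Y Z := by
    rw [map_smul, LinearMap.smul_apply, LinearMap.smul_apply]
  have h2 := congrArg (fun V ↦ V.1 ⟨x, hx⟩) h
  simpa only [SmoothField.smul_apply, hR, SmoothFun.algebraMap_apply] using h2

theorem curvature_swap (x : M) (u v w : TangentSpace I x) :
    g.curvature x u v w = -g.curvature x v u w := by
  have hx := mem_baseSet_trivializationAt E (TangentSpace I : M → Type _) x
  have hU := (trivializationAt E (TangentSpace I : M → Type _) x).open_baseSet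
  have ev := SmoothField.exists_apply_eq (I := I) (x₀ := x) subset_rfl ⟨x, hx⟩
  have hR := fun X Y Z ↦ g.calculus_R_apply hU subset_rfl X Y Z ⟨x, hx⟩
  obtain ⟨X, rfl⟩ := ev u
  obtain ⟨Y, rfl⟩ := ev v
  obtain ⟨Z, rfl⟩ := ev w
  have h2 := congrArg (fun V ↦ V.1 ⟨x, hx⟩) ((g.calculus hU subset_rfl).R_swap X Y Z)
  simpa only [SmoothField.neg_apply, hR] using h2

theorem curvature_add_right (x : M) (u v v' w : TangentSpace I x) :
    g.curvature x u (v + v') w = g.curvature x u v w + g.curvature x u v' w := by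
  rw [curvature_swap, curvature_add_left, neg_add, ← curvature_swap, ← curvature_swap]

theorem curvature_smul_right (x : M) (c : ℝ) (u v w : TangentSpace I x) :
    g.curvature x u (c • v) w = c • g.curvature x u v w := by
  rw [curvature_swap, curvature_smul_left, ← smul_neg, ← curvature_swap]

theorem curvature_add (x : M) (u v w w' : TangentSpace I x) :
    g.curvature x u v (w + w') = g.curvature x u v w + g.curvature x u v w' := by
  have hx := mem_baseSet_trivializationAt E (TangentSpace I : M → Type _) x
  have hU := (trivializationAt E (TangentSpace I : M → Type _) x).open_baseSet
  have ev := SmoothField.exists_apply_eq (I := I) (x₀ := x) subset_rfl ⟨x, hx⟩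
  have hR := fun X Y Z ↦ g.calculus_R_apply hU subset_rfl X Y Z ⟨x, hx⟩
  generalize (g.calculus hU subset_rfl).R = R at hR
  obtain ⟨X, rfl⟩ := ev u
  obtain ⟨Y, rfl⟩ := ev v
  obtain ⟨Z, rfl⟩ := ev w
  obtain ⟨Z', rfl⟩ := ev w'
  have h : R X Y (Z + Z') = R X Y Z + R X Y Z' := by
    rw [map_add]
  have h2 := congrArg (fun V ↦ V.1 ⟨x, hx⟩) h
  simpa only [SmoothField.add_apply, hR] using h2

theorem curvature_smul (x : M) (c : ℝ) (u v w : TangentSpace I x) :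
    g.curvature x u v (c • w) = c • g.curvature x u v w := by
  have hx := mem_baseSet_trivializationAt E (TangentSpace I : M → Type _) x
  have hU := (trivializationAt E (TangentSpace I : M → Type _) x).open_baseSet
  have ev := SmoothField.exists_apply_eq (I := I) (x₀ := x) subset_rfl ⟨x, hx⟩
  have hR := fun X Y Z ↦ g.calculus_R_apply hU subset_rfl X Y Z ⟨x, hx⟩
  generalize (g.calculus hU subset_rfl).R = R at hR
  obtain ⟨X, rfl⟩ := ev u
  obtain ⟨Y, rfl⟩ := ev v
  obtain ⟨Z, rfl⟩ := ev w
  have h : R X Y (algebraMap ℝ (SmoothFun I (trivializationAt E (TangentSpace I : M → Type _) x).baseSet) c • Z) =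
      (algebraMap ℝ (SmoothFun I (trivializationAt E (TangentSpace I : M → Type _) x).baseSet) c) •
        R X Y Z := by
    rw [map_smul]
  have h2 := congrArg (fun V ↦ V.1 ⟨x, hx⟩) h
  simpa only [SmoothField.smul_apply, hR, SmoothFun.algebraMap_apply] using h2

/-- The curvature tensor as a trilinear map. -/
def curvatureHom (x : M) : TangentSpace I x →ₗ[ℝ] TangentSpace I x →ₗ[ℝ] TangentSpace I x →ₗ[ℝ]
    TangentSpace I x :=
  LinearMap.mk₂ ℝ (fun u v ↦
    { toFun := fun w ↦ g.curvature x u v w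
      map_add' := g.curvature_add x u v
      map_smul' := fun c ↦ g.curvature_smul x c u v })
    (fun u u' v ↦ LinearMap.ext (g.curvature_add_left x u u' v))
    (fun c u v ↦ LinearMap.ext (g.curvature_smul_left x c u v))
    (fun u v v' ↦ LinearMap.ext (g.curvature_add_right x u v v'))
    (fun c u v ↦ LinearMap.ext (g.curvature_smul_right x c u v))

end PseudoRiemannianMetric

end Tensoriality

/-! ### The geometric contact structure satisfies the algebraic axioms. -/

section ContactStructure

theorem extDerivOneForm_swap (η : Π x : M, TangentSpace I x →L[ℝ] ℝ) (x : M)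
    (u v : TangentSpace I x) : extDerivOneForm η x u v = -extDerivOneForm η x v u := by
  simp only [extDerivOneForm, mlieBracket_swap_apply (V := extend E v)]
  rw [map_neg]
  ring

namespace ContactPseudoMetricStructure

variable (S : ContactPseudoMetricStructure I M) (x : M)

theorem ε_mul_ε : S.ε * S.ε = 1 := by rcases S.ε_eq with h | h <;> simp [h]

/-- Skewness of Φ is inherited from dη. -/
theorem g_φ_right (u v : TangentSpace I x) : S.g.val x u (S.φ x v) = -S.g.val x v (S.φ x u) := by
  rw [← S.dη_eq, ← S.dη_eq, extDerivOneForm_swap]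

theorem g_φ_left (u v : TangentSpace I x) : S.g.val x (S.φ x u) v = -S.g.val x u (S.φ x v) := by
  rw [S.g.symm, g_φ_right]

theorem g_ξ_right (u : TangentSpace I x) : S.g.val x u (S.ξ x) = S.ε * S.η x u := by
  have h := S.g_φ_φ x u (S.ξ x)
  rw [g_φ_left, S.φ_φ, S.η_ξ] at h
  simp only [map_add, map_neg, map_smul, smul_eq_mul] at h
  linarith

/-- φ²ξ = 0 by the formula for φ², and η(φξ) = 0 because Φ(ξ,ξ) = 0; the formula for φ² applied to
φξ then gives φξ = 0. -/
theorem φ_ξ : S.φ x (S.ξ x) = 0 := by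
  have h0 : S.φ x (S.φ x (S.ξ x)) = 0 := by simp [S.φ_φ, S.η_ξ]
  have h1 : S.η x (S.φ x (S.ξ x)) = 0 := by
    have h2 := S.g_φ_right x (S.ξ x) (S.ξ x)
    rw [S.g.symm, g_ξ_right] at h2
    have h3 := S.ε_mul_ε
    linear_combination (-S.η x (S.φ x (S.ξ x))) * h3 + S.ε / 2 * h2
  simpa [h0, h1] using S.φ_φ x (S.φ x (S.ξ x))

theorem η_φ (u : TangentSpace I x) : S.η x (S.φ x u) = 0 := by
  have h := S.g_φ_left x u (S.ξ x)
  rw [g_ξ_right, φ_ξ, map_zero, neg_zero] at h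
  linear_combination S.ε * h - S.η x (S.φ x u) * S.ε_mul_ε

/-- Write η = εg(·,ξ) in dη and differentiate by metric compatibility; torsion-freeness cancels the
bracket, leaving only derivatives of ξ. -/
theorem g_leviCivita_ξ (u v : TangentSpace I x) :
    S.g.val x v (S.g.leviCivita S.ξ x u) - S.g.val x u (S.g.leviCivita S.ξ x v) =
      2 * S.ε * S.g.val x u (S.φ x v) := by
  have hξ : MDiffAt (T% S.ξ) x := S.contMDiff_ξ.mdifferentiableAt (by simp)
  have hd {V : Π y : M, TangentSpace I y} (w : TangentSpace I x) (hV : MDiffAt (T% V) x) :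
      d% (fun y ↦ S.η y (V y)) x w =
        S.ε * (S.g.val x (S.g.leviCivita V x w) (S.ξ x)
          + S.g.val x (V x) (S.g.leviCivita S.ξ x w)) := by
    have h1 : (fun y ↦ S.η y (V y)) = (fun _ ↦ S.ε) * fun y ↦ S.g.val y (V y) (S.ξ y) := by
      ext y
      simp only [Pi.mul_apply, g_ξ_right]
      rw [← mul_assoc, ε_mul_ε, one_mul]
    have h2 := S.g.leviCivita_metric (mdifferentiableAt_extend I E w) hV hξ
    rw [extend_apply_self] at h2
    rw [h1, mvfderiv_mul mdifferentiableAt_const (S.g.mdifferentiableAt_val hV hξ), mvfderiv_const,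
      ← h2]
    simp
  have hu := mdifferentiableAt_extend I E u
  have hv := mdifferentiableAt_extend I E v
  have h1 := S.dη_eq x u v
  have h2 := (CovariantDerivative.torsion_eq_zero_iff _).1 S.g.torsion_leviCivita hu hv
  rw [extDerivOneForm, hd u hv, hd v hu, ← h2] at h1
  simp only [extend_apply_self, map_sub, g_ξ_right] at h1
  rw [← h1]
  linear_combination -(S.g.val x v (S.g.leviCivita S.ξ x u) -
    S.g.val x u (S.g.leviCivita S.ξ x v) + S.ε * (S.η x (S.g.leviCivita (extend E v) x u)
    - S.η x (S.g.leviCivita (extend E u) x v))) * S.ε_mul_ε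

variable {U : Set M}

theorem contMDiffAt_φ {X : Π y : M, TangentSpace I y} {x : M} (hX : CMDiffAt ∞ (T% X) x) :
    CMDiffAt ∞ (T% (fun y ↦ S.φ y (X y))) x :=
  contMDiffAt_endo_apply S.contMDiff_φ.contMDiffAt hX

theorem contMDiffAt_ξ (x : M) : CMDiffAt ∞ (T% S.ξ) x := S.contMDiff_ξ.contMDiffAt

/-- The action of `φ` on vector fields. -/
def fieldφ (X : SmoothField I U) : SmoothField I U :=
  .of (fun y ↦ S.φ y (X.lift y)) fun _ hy ↦ S.contMDiffAt_φ (X.contMDiffAt_lift hy)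

theorem fieldφ_apply (X : SmoothField I U) (y : U) : (S.fieldφ X).1 y = S.φ y (X.1 y) := by
  rw [← X.lift_apply]; rfl

/-- The action of `η` on vector fields. -/
def fieldη (X : SmoothField I U) : SmoothFun I U :=
  .of (fun y ↦ S.η y (X.lift y))
    fun _ hy ↦ contMDiffAt_oneForm_apply S.contMDiff_η.contMDiffAt (X.contMDiffAt_lift hy)

theorem fieldη_apply (X : SmoothField I U) (y : U) : (S.fieldη X).1 y = S.η y (X.1 y) := by
  rw [← X.lift_apply]; rfl

variable [Nontrivial E]

/-- The contact calculus of vector fields on a trivializing open set. -/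
def calculus (hU : IsOpen U) {x₀ : M}
    (hx₀ : U ⊆ (trivializationAt E (TangentSpace I) x₀).baseSet) :
    ContactCalculus (SmoothFun I U) (SmoothField I U) where
  toMetricCalculus := S.g.calculus hU hx₀
  φ :=
    { toFun := S.fieldφ
      map_add' := fun X Y ↦ by ext y; simp [fieldφ_apply]
      map_smul' := fun f X ↦ by ext y; simp [fieldφ_apply] }
  ξ := .of S.ξ fun y _ ↦ S.contMDiffAt_ξ y
  η :=
    { toFun := S.fieldη
      map_add' := fun X Y ↦ by ext y; simp [fieldη_apply]
      map_smul' := fun f X ↦ by ext y; simp [fieldη_apply] }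
  ε := algebraMap ℝ _ S.ε
  D_ε X := Derivation.map_algebraMap _ _
  ε_sq := by rw [← map_mul, ε_mul_ε, map_one]
  η_ξ := by ext y; exact (S.fieldη_apply _ y).trans (S.η_ξ y)
  φ_φ X := by
    ext y
    change (S.fieldφ (S.fieldφ X)).1 y = -X.1 y + (S.fieldη X).1 y • S.ξ y
    rw [fieldφ_apply, fieldφ_apply, fieldη_apply, S.φ_φ]
  φ_ξ := by ext y; exact (S.fieldφ_apply _ y).trans (S.φ_ξ y)
  η_φ X := by
    ext y
    change (S.fieldη (S.fieldφ X)).1 y = 0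
    rw [fieldη_apply, fieldφ_apply, η_φ]
  g_ξ X := by
    ext y
    change (S.g.fieldInner X (.of S.ξ fun y _ ↦ S.contMDiffAt_ξ y)).1 y = S.ε * (S.fieldη X).1 y
    rw [PseudoRiemannianMetric.fieldInner_apply, fieldη_apply, ← g_ξ_right]
    rfl
  g_φ X Y := by
    ext y
    change (S.g.fieldInner (S.fieldφ X) Y).1 y = -(S.g.fieldInner X (S.fieldφ Y)).1 y
    rw [PseudoRiemannianMetric.fieldInner_apply, PseudoRiemannianMetric.fieldInner_apply,
      fieldφ_apply, fieldφ_apply, g_φ_left]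
  dη X Y := by
    ext y
    change (S.g.fieldInner Y (S.g.fieldConn X (.of S.ξ fun y _ ↦ S.contMDiffAt_ξ y))).1 y -
      (S.g.fieldInner X (S.g.fieldConn Y (.of S.ξ fun y _ ↦ S.contMDiffAt_ξ y))).1 y =
      2 * S.ε * (S.g.fieldInner X (S.fieldφ Y)).1 y
    simp only [PseudoRiemannianMetric.fieldInner_apply, fieldφ_apply]
    rw [S.g.fieldConn_of_apply hU, S.g.fieldConn_of_apply hU, g_leviCivita_ξ]

section Values

variable (hU : IsOpen U) {x₀ : M} (hx₀ : U ⊆ (trivializationAt E (TangentSpace I) x₀).baseSet)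
  (X Y Z : SmoothField I U) (y : U)

theorem calculus_φ_apply : ((S.calculus hU hx₀).φ X).1 y = S.φ y (X.1 y) := S.fieldφ_apply X y

theorem calculus_η_apply : ((S.calculus hU hx₀).η X).1 y = S.η y (X.1 y) := S.fieldη_apply X y

theorem calculus_ξ_apply : (S.calculus hU hx₀).ξ.1 y = S.ξ y := rfl

theorem calculus_ε_apply : (S.calculus hU hx₀).ε.1 y = S.ε := rfl

theorem calculus_g_apply : ((S.calculus hU hx₀).g X Y).1 y = S.g.val y (X.1 y) (Y.1 y) :=
  S.g.fieldInner_apply X Y y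

theorem calculus_R_apply :
    ((S.calculus hU hx₀).R X Y Z).1 y = S.g.curvature y (X.1 y) (Y.1 y) (Z.1 y) :=
  S.g.calculus_R_apply hU hx₀ X Y Z y

theorem calculus_S_apply : ((S.calculus hU hx₀).S X).1 y = S.g.leviCivita S.ξ y (X.1 y) :=
  S.g.fieldConn_of_apply hU X (fun z _ ↦ S.contMDiffAt_ξ z) y

theorem calculus_h_apply_eq : ((S.calculus hU hx₀).h X).1 y =
    S.φ y (S.g.leviCivita S.ξ y (X.1 y)) + S.ε • S.φ y (S.φ y (X.1 y)) := by
  rw [ContactCalculus.h_apply, SmoothField.add_apply, SmoothField.smul_apply, calculus_φ_apply,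
    calculus_S_apply, calculus_φ_apply, calculus_φ_apply, calculus_ε_apply]

end Values

/-- `two_h` for the extension of u, the bracket of the calculus being the Lie bracket. It also shows
that h, defined through an extension, is linear in u. -/
theorem h_eq (u : TangentSpace I x) :
    S.h x u = S.φ x (S.g.leviCivita S.ξ x u) + S.ε • S.φ x (S.φ x u) := by
  have hx := mem_baseSet_trivializationAt E (TangentSpace I : M → Type _) x
  have hU := (trivializationAt E (TangentSpace I : M → Type _) x).open_baseSet
  set U := (trivializationAt E (TangentSpace I : M → Type _) x).baseSet
  have hF y (hy : y ∈ U) := contMDiffAt_extend_of_mem u hy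
  have h1 := (S.calculus hU subset_rfl).two_h (.of _ hF)
  have h2 := congrArg (fun V ↦ V.1 ⟨x, hx⟩) h1
  have h3 : (S.calculus hU subset_rfl).φ (.of _ hF) =
      .of (fun y ↦ S.φ y (extend E u y)) fun y hy ↦ S.contMDiffAt_φ (hF y hy) := by
    ext y; exact S.calculus_φ_apply hU subset_rfl _ y
  have hb {G : Π y : M, TangentSpace I y} (hG : ∀ y ∈ U, CMDiffAt ∞ (T% G) y) :
      (S.calculus hU subset_rfl).br (S.calculus hU subset_rfl).ξ (.of G hG) =
        .of (mlieBracket I S.ξ G)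
          fun y hy ↦ contMDiffAt_mlieBracket (S.contMDiffAt_ξ y) (hG y hy) :=
    S.g.fieldConn_sub_fieldConn hU (fun y _ ↦ S.contMDiffAt_ξ y) hG
  rw [h3, hb, hb] at h2
  simp only [SmoothField.sub_apply, calculus_φ_apply, SmoothField.of_apply, SmoothField.smul_apply,
    calculus_h_apply_eq, extend_apply_self] at h2
  rw [h, lieDerivEndo, h2]
  have h4 : (2 : SmoothFun I U).1 ⟨x, hx⟩ = 2 := rfl
  rw [h4, smul_smul]
  norm_num

theorem calculus_h_apply (hU : IsOpen U) {x₀ : M}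
    (hx₀ : U ⊆ (trivializationAt E (TangentSpace I) x₀).baseSet) (X : SmoothField I U) (y : U) :
    ((S.calculus hU hx₀).h X).1 y = S.h y (X.1 y) := by
  rw [calculus_h_apply_eq, h_eq]

end ContactPseudoMetricStructure

end ContactStructure

/-! ### Evaluating the identities of the calculus at a point. -/

section PointwiseTensor

namespace ContactPseudoMetricStructure

variable (S : ContactPseudoMetricStructure I M) (x : M) [Nontrivial E]

/-- The calculus of vector fields near `x`. -/
abbrev calculusAt : ContactCalculus
    (SmoothFun I (trivializationAt E (TangentSpace I : M → Type _) x).baseSet)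
    (SmoothField I (trivializationAt E (TangentSpace I : M → Type _) x).baseSet) :=
  S.calculus (trivializationAt E (TangentSpace I : M → Type _) x).open_baseSet subset_rfl

/-- The point `x` in its trivializing neighbourhood. -/
abbrev basePoint (x : M) : (trivializationAt E (TangentSpace I : M → Type _) x).baseSet :=
  ⟨x, mem_baseSet_trivializationAt E (TangentSpace I : M → Type _) x⟩

theorem exists_field (u : TangentSpace I x) :
    ∃ X : SmoothField I (trivializationAt E (TangentSpace I : M → Type _) x).baseSet,
      X.1 (basePoint x) = u :=
  SmoothField.exists_apply_eq subset_rfl (basePoint x) u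

/-- The commutator identities assume η = 0 for the fields and not only at the point, so the
ξ-component of an extension is subtracted everywhere. -/
theorem exists_horizontal_field {u : TangentSpace I x} (hu : S.η x u = 0) :
    ∃ X : SmoothField I (trivializationAt E (TangentSpace I : M → Type _) x).baseSet,
      X.1 (basePoint x) = u ∧ (S.calculusAt x).η X = 0 := by
  obtain ⟨X, rfl⟩ := exists_field x u
  refine ⟨X - (S.calculusAt x).η X • (S.calculusAt x).ξ, ?_, by
    rw [map_sub, map_smul, ContactCalculus.η_ξ, smul_eq_mul, mul_one, sub_self]⟩
  rw [SmoothField.sub_apply, SmoothField.smul_apply, calculus_η_apply, hu, zero_smul, sub_zero]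

theorem curvature_bianchi (u v w : TangentSpace I x) :
    S.g.curvature x u v w + S.g.curvature x v w u + S.g.curvature x w u v = 0 := by
  obtain ⟨X, rfl⟩ := exists_field x u
  obtain ⟨Y, rfl⟩ := exists_field x v
  obtain ⟨Z, rfl⟩ := exists_field x w
  have h := congrArg (fun V ↦ V.1 (basePoint x)) ((S.calculusAt x).bianchi X Y Z)
  simpa only [SmoothField.add_apply, calculus_R_apply, SmoothField.zero_apply] using h

theorem g_curvature_skew (u v w z : TangentSpace I x) :
    S.g.val x (S.g.curvature x u v w) z = -S.g.val x w (S.g.curvature x u v z) := by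
  obtain ⟨X, rfl⟩ := exists_field x u
  obtain ⟨Y, rfl⟩ := exists_field x v
  obtain ⟨Z, rfl⟩ := exists_field x w
  obtain ⟨W, rfl⟩ := exists_field x z
  have h := congrArg (fun V ↦ V.1 (basePoint x)) ((S.calculusAt x).g_R_skew X Y Z W)
  simpa only [SmoothFun.neg_apply, calculus_g_apply, calculus_R_apply] using h

theorem g_curvature_pair (u v w z : TangentSpace I x) :
    S.g.val x (S.g.curvature x u v w) z = S.g.val x (S.g.curvature x w z u) v := by
  obtain ⟨X, rfl⟩ := exists_field x u
  obtain ⟨Y, rfl⟩ := exists_field x v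
  obtain ⟨Z, rfl⟩ := exists_field x w
  obtain ⟨W, rfl⟩ := exists_field x z
  have h := congrArg (fun V ↦ V.1 (basePoint x)) ((S.calculusAt x).g_R_pair X Y Z W)
  simpa only [calculus_g_apply, calculus_R_apply] using h

/-- The tensor `h` as a linear map. -/
def hHom : TangentSpace I x →ₗ[ℝ] TangentSpace I x :=
  (S.φ x ∘L S.g.leviCivita S.ξ x + S.ε • S.φ x ∘L S.φ x : TangentSpace I x →L[ℝ] _)

theorem hHom_apply (u : TangentSpace I x) : S.hHom x u = S.h x u := (S.h_eq x u).symm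

theorem h_ξ : S.h x (S.ξ x) = 0 := by
  have h := congrArg (fun V ↦ V.1 (basePoint x)) (S.calculusAt x).h_ξ
  simpa only [calculus_h_apply, calculus_ξ_apply, SmoothField.zero_apply] using h

theorem η_h (u : TangentSpace I x) : S.η x (S.h x u) = 0 := by
  rw [h_eq, map_add, map_smul, η_φ, η_φ, smul_zero, add_zero]

theorem h_φ (u : TangentSpace I x) : S.h x (S.φ x u) = -S.φ x (S.h x u) := by
  obtain ⟨X, rfl⟩ := exists_field x u
  have h := congrArg (fun V ↦ V.1 (basePoint x)) ((S.calculusAt x).h_φ X)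
  simpa only [calculus_h_apply, calculus_φ_apply, SmoothField.neg_apply] using h

theorem g_h (u v : TangentSpace I x) : S.g.val x (S.h x u) v = S.g.val x u (S.h x v) := by
  obtain ⟨X, rfl⟩ := exists_field x u
  obtain ⟨Y, rfl⟩ := exists_field x v
  have h := congrArg (fun V ↦ V.1 (basePoint x)) ((S.calculusAt x).g_h X Y)
  simpa only [calculus_g_apply, calculus_h_apply] using h

variable {S} {κ μ : ℝ} (hS : S.IsKappaMu κ μ)
include hS

theorem IsKappaMu.calculus {U : Set M} (hU : IsOpen U) {x₀ : M}
    (hx₀ : U ⊆ (trivializationAt E (TangentSpace I) x₀).baseSet) :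
    (S.calculus hU hx₀).IsKappaMu (algebraMap ℝ _ κ) (algebraMap ℝ _ μ) := by
  refine ⟨fun X ↦ Derivation.map_algebraMap _ _, fun X ↦ Derivation.map_algebraMap _ _,
    fun X Y ↦ ?_⟩
  ext y
  simp only [SmoothField.add_apply, SmoothField.sub_apply, SmoothField.smul_apply,
    SmoothFun.mul_apply, SmoothFun.algebraMap_apply, calculus_R_apply, calculus_ε_apply,
    calculus_η_apply, calculus_h_apply, calculus_ξ_apply]
  exact hS y (X.1 y) (Y.1 y)

theorem IsKappaMu.h_h (u : TangentSpace I x) :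
    S.h x (S.h x u) = (S.ε * κ - 1) • S.φ x (S.φ x u) := by
  obtain ⟨X, rfl⟩ := exists_field x u
  have h := congrArg (fun V ↦ V.1 (basePoint x)) (((S.calculusAt x).h_h X).trans
    ((hS.calculus _ subset_rfl).W_W X))
  simpa only [calculus_h_apply, calculus_φ_apply, SmoothField.smul_apply, SmoothFun.sub_apply,
    SmoothFun.mul_apply, SmoothFun.one_apply, SmoothFun.algebraMap_apply, calculus_ε_apply] using h

omit hS in
-- Supplies the inverse `a` of 1 - εκ in the ring of functions; here εκ < 1 excludes zero.
theorem algebraMap_inv_mul {U : Set M} (hU : IsOpen U) {x₀ : M}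
    (hx₀ : U ⊆ (trivializationAt E (TangentSpace I) x₀).baseSet) (hκ : S.ε * κ < 1) :
    algebraMap ℝ (SmoothFun I U) (1 - S.ε * κ)⁻¹ *
      (1 - (S.calculus hU hx₀).ε * algebraMap ℝ _ κ) = 1 := by
  ext y
  exact inv_mul_cancel₀ (sub_pos.2 hκ).ne'

theorem IsKappaMu.g_curvature_φ (hκ : S.ε * κ < 1) (u v : TangentSpace I x)
    {w z : TangentSpace I x} (hw : S.η x w = 0) (hz : S.η x z = 0) :
    S.g.val x (S.g.curvature x u v (S.φ x w)) z + S.g.val x (S.g.curvature x u v w) (S.φ x z) =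
      S.ε * (S.g.val x (S.ε • u + S.h x u) w * S.g.val x (S.φ x (S.ε • v + S.h x v)) z -
        S.g.val x (S.φ x (S.ε • v + S.h x v)) w * S.g.val x (S.ε • u + S.h x u) z) -
      S.ε * (S.g.val x (S.ε • v + S.h x v) w * S.g.val x (S.φ x (S.ε • u + S.h x u)) z -
        S.g.val x (S.φ x (S.ε • u + S.h x u)) w * S.g.val x (S.ε • v + S.h x v) z) := by
  obtain ⟨X, rfl⟩ := exists_field x u
  obtain ⟨Y, rfl⟩ := exists_field x v
  obtain ⟨Z, rfl, hZ⟩ := S.exists_horizontal_field x hw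
  obtain ⟨W, rfl, hW⟩ := S.exists_horizontal_field x hz
  have h := congrArg (fun V ↦ V.1 (basePoint x)) ((hS.calculus _ subset_rfl).g_R_φ
    (algebraMap_inv_mul _ subset_rfl hκ) hZ hW X Y)
  simp only [ContactCalculus.S_eq_φ_P, ContactCalculus.P_apply, map_neg, LinearMap.neg_apply,
    calculus_g_apply, calculus_R_apply, calculus_h_apply, calculus_φ_apply,
    SmoothField.add_apply, SmoothField.smul_apply, SmoothFun.add_apply, SmoothFun.sub_apply,
    SmoothFun.mul_apply, SmoothFun.neg_apply, calculus_ε_apply] at h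
  rw [h]; ring

theorem IsKappaMu.g_curvature_φ_h (hκ : S.ε * κ < 1) {u v w z : TangentSpace I x}
    (hu : S.η x u = 0) (hv : S.η x v = 0) (hw : S.η x w = 0) (hz : S.η x z = 0) :
    S.g.val x (S.g.curvature x u v (S.φ x (S.h x w))) z -
        S.g.val x (S.g.curvature x u v w) (S.φ x (S.h x z)) =
      S.ε * (S.g.val x (S.h x (S.ε • u + S.h x u)) w * S.g.val x (S.φ x (S.ε • v + S.h x v)) z +
        S.g.val x (S.φ x (S.ε • v + S.h x v)) w * S.g.val x (S.h x (S.ε • u + S.h x u)) z) -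
      S.ε * (S.g.val x (S.h x (S.ε • v + S.h x v)) w * S.g.val x (S.φ x (S.ε • u + S.h x u)) z +
        S.g.val x (S.φ x (S.ε • u + S.h x u)) w * S.g.val x (S.h x (S.ε • v + S.h x v)) z) +
      2 * S.ε * μ * S.g.val x u (S.φ x v) * S.g.val x (S.h x w) z := by
  obtain ⟨X, rfl, hX⟩ := S.exists_horizontal_field x hu
  obtain ⟨Y, rfl, hY⟩ := S.exists_horizontal_field x hv
  obtain ⟨Z, rfl, hZ⟩ := S.exists_horizontal_field x hw
  obtain ⟨W, rfl, hW⟩ := S.exists_horizontal_field x hz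
  have h := congrArg (fun V ↦ V.1 (basePoint x)) ((hS.calculus _ subset_rfl).g_R_W
    (algebraMap_inv_mul _ subset_rfl hκ) hX hY hZ hW)
  have h2 : (2 : SmoothFun I
      (trivializationAt E (TangentSpace I : M → Type _) x).baseSet).1 (basePoint x) = 2 := rfl
  simp only [ContactCalculus.S_eq_φ_P, ContactCalculus.P_apply, ContactCalculus.W_apply, map_neg,
    LinearMap.neg_apply, calculus_g_apply, calculus_R_apply, calculus_h_apply, calculus_φ_apply,
    SmoothField.add_apply, SmoothField.smul_apply, SmoothFun.add_apply, SmoothFun.sub_apply,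
    SmoothFun.mul_apply, SmoothFun.neg_apply, SmoothFun.algebraMap_apply, calculus_ε_apply,
    h2] at h
  rw [h]; ring

/-- The curvature at a point of a `(κ, μ)`-contact pseudo-metric manifold. -/
def IsKappaMu.tensor (hκ : S.ε * κ < 1) : KappaMuTensor (TangentSpace I x) where
  g := S.g.bilin x
  R := S.g.curvatureHom x
  φ := S.φ x
  h := S.hHom x
  ξ := S.ξ x
  η := S.η x
  ε := S.ε
  κ := κ
  μ := μ
  g_symm := S.g.symm x
  g_nondeg := S.g.nondegenerate x
  R_swap := S.g.curvature_swap x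
  bianchi := S.curvature_bianchi x
  g_R_skew := S.g_curvature_skew x
  g_R_pair := S.g_curvature_pair x
  ε_sq := S.ε_mul_ε
  η_ξ := S.η_ξ x
  φ_φ := S.φ_φ x
  η_φ := S.η_φ x
  g_ξ := S.g_ξ_right x
  g_φ := S.g_φ_left x
  h_ξ := by rw [hHom_apply, h_ξ]
  η_h X := by rw [hHom_apply]; exact S.η_h x X
  h_φ X := by rw [hHom_apply, hHom_apply]; exact S.h_φ x X
  g_h X Y := by rw [hHom_apply, hHom_apply]; exact S.g_h x X Y
  h_h X := by rw [hHom_apply, hHom_apply]; exact hS.h_h x X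
  R_ξ X Y := by rw [hHom_apply, hHom_apply]; exact hS x X Y
  g_R_φ X Y Z U hZ hU := by
    rw [hHom_apply, hHom_apply]; exact hS.g_curvature_φ x hκ X Y hZ hU
  g_R_W X Y Z U hX hY hZ hU := by
    simp only [hHom_apply]; exact hS.g_curvature_φ_h x hκ hX hY hZ hU

end ContactPseudoMetricStructure

end PointwiseTensor

/-! ### Sectional curvatures and the Ricci operator on the manifold. -/

section MainResults

namespace ContactPseudoMetricStructure.IsKappaMu

variable {S : ContactPseudoMetricStructure I M} {κ μ : ℝ} (hS : S.IsKappaMu κ μ) (x : M)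
include hS

theorem sectionalCurvature_ξ {X : TangentSpace I x} (hX : S.g.val x X (S.ξ x) = 0)
    (hX0 : S.g.val x X X ≠ 0) :
    S.g.sectionalCurvature x X (S.ξ x) = κ + μ * (S.g.val x (S.h x X) X / S.g.val x X X) := by
  have hε : S.ε ≠ 0 := left_ne_zero_of_mul_eq_one S.ε_mul_ε
  have hη : S.η x X = 0 := by
    rw [S.g_ξ_right] at hX
    exact (mul_eq_zero.1 hX).resolve_left hε
  have hξ : S.g.val x (S.ξ x) (S.ξ x) = S.ε := by rw [S.g_ξ_right, S.η_ξ, mul_one]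
  rw [PseudoRiemannianMetric.sectionalCurvature, PseudoRiemannianMetric.curvature₄, hS, hX, hξ,
    hη, S.η_ξ]
  simp only [one_smul, zero_smul, sub_zero, map_add, map_smul, add_apply, smul_apply, smul_eq_mul]
  field_simp
  ring

variable [Nontrivial E] (hκ : S.ε * κ < 1)
include hκ

theorem sectionalCurvature_eigen {c : ℝ} (hc : (hS.tensor x hκ).IsEigenvalue c)
    {X Y : TangentSpace I x} (hX : X ∈ S.D c x) (hY : Y ∈ S.D c x)
    (hXY : S.g.IsNondegeneratePlane x X Y) :
    S.g.sectionalCurvature x X Y = 2 * (S.ε + c) - S.ε * μ := by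
  have hX' : S.hHom x X = c • X := by rw [hHom_apply]; exact hX
  have hY' : S.hHom x Y = c • Y := by rw [hHom_apply]; exact hY
  have h : S.g.val x (S.g.curvature x X Y Y) X = (2 * S.ε + 2 * c - S.ε * μ) *
      (S.g.val x Y Y * S.g.val x X X - S.g.val x X Y * S.g.val x Y X) :=
    KappaMuTensor.g_R_same (C := hS.tensor x hκ) hc hX' hY' hY' hX'
  rw [PseudoRiemannianMetric.sectionalCurvature, PseudoRiemannianMetric.curvature₄, h,
    div_eq_iff hXY, S.g.symm x Y X]
  ring

/-- The numerator is a mixed component, brought by pair symmetry to the order of `g_R_mixed`;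
orthogonality of the eigenspaces reduces the denominator to g(X,X)g(Y,Y). -/
theorem sectionalCurvature_eigen_neg {c : ℝ} (hc : (hS.tensor x hκ).IsEigenvalue c)
    {X Y : TangentSpace I x} (hX : X ∈ S.D c x) (hY : Y ∈ S.D (-c) x) :
    S.g.sectionalCurvature x X Y =
      -(κ + S.ε * μ) * (S.g.val x X (S.φ x Y) ^ 2 / (S.g.val x X X * S.g.val x Y Y)) := by
  have hX' : S.hHom x X = c • X := by rw [hHom_apply]; exact hX
  have hY' : S.hHom x Y = (-c) • Y := by rw [hHom_apply]; exact hY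
  have h : S.g.val x (S.g.curvature x Y X X) Y =
      κ * S.g.val x (S.φ x Y) X * S.g.val x (S.φ x X) Y -
        S.ε * μ * S.g.val x Y (S.φ x X) * S.g.val x (S.φ x X) Y :=
    KappaMuTensor.g_R_mixed (C := hS.tensor x hκ) hc hY' hX' hX' hY'
  have h0 : S.g.val x X Y = 0 := KappaMuTensor.g_eq_zero_of_eigen (C := hS.tensor x hκ) hc.1 hX' hY'
  have h1 : S.g.val x (S.g.curvature x X Y Y) X = S.g.val x (S.g.curvature x Y X X) Y := by
    rw [S.g_curvature_pair]
  rw [PseudoRiemannianMetric.sectionalCurvature, PseudoRiemannianMetric.curvature₄, h1, h, h0,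
    S.g_φ_left x X Y, S.g.symm x (S.φ x Y) X, S.g_φ_right x Y X]
  ring

theorem ricci_eq (u v : TangentSpace I x) : S.g.ricci x u v = (hS.tensor x hκ).ric u v := by
  rw [KappaMuTensor.ric_apply, LinearMap.trace_eq_matrix_trace ℝ
    (Module.finBasis ℝ (TangentSpace I x)), Matrix.trace]
  refine Finset.sum_congr rfl fun i _ ↦ ?_
  rw [Matrix.diag_apply, LinearMap.toMatrix_apply]
  rfl

theorem ricciOperator_eq {n : ℕ} (hn : Module.finrank ℝ E = 2 * n + 1) {c : ℝ}
    (hc : (hS.tensor x hκ).IsEigenvalue c) (X : TangentSpace I x) :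
    S.g.ricciOperator x X =
      (S.ε * (2 * ((n : ℝ) - 1) - n * μ)) • X + (2 * ((n : ℝ) - 1) + μ) • S.h x X
        + ((2 * (1 - (n : ℝ)) * S.ε + 2 * n * κ + n * S.ε * μ) * S.η x X) • S.ξ x := by
  refine S.g.ext_val fun v ↦ ?_
  have h : (Module.finBasis ℝ (TangentSpace I x)).constr ℝ
      (fun i ↦ S.g.ricci x X (Module.finBasis ℝ (TangentSpace I x) i)) =
      (hS.tensor x hκ).ric X := by
    refine (Module.finBasis ℝ (TangentSpace I x)).ext fun i ↦ ?_
    rw [Module.Basis.constr_basis, hS.ricci_eq x hκ]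
  rw [PseudoRiemannianMetric.ricciOperator, PseudoRiemannianMetric.val_sharp, h,
    KappaMuTensor.ric_eq hc hn, ← hHom_apply]
  rfl

end ContactPseudoMetricStructure.IsKappaMu

end MainResults

end

/-- Sectional curvatures and Ricci operator of a `(κ, μ)`-contact pseudo-metric manifold with
`εκ < 1`; here `λ = √(1 - εκ)` and `D(±λ)` are eigenspaces of `h`. -/
theorem mainTheorem6 (n : ℕ) {M : Type*} [TopologicalSpace M]
    [ChartedSpace (EuclideanSpace ℝ (Fin (2 * n + 1))) M] [IsManifold (𝓡 (2 * n + 1)) ∞ M]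
    (S : ContactPseudoMetricStructure (𝓡 (2 * n + 1)) M) (κ μ : ℝ) (hS : S.IsKappaMu κ μ)
    (hκ : S.ε * κ < 1) (lam : ℝ) (hlam : lam = √(1 - S.ε * κ)) (x : M) :
    (∀ X : TangentSpace (𝓡 (2 * n + 1)) x,
      S.g.val x X (S.ξ x) = 0 → S.g.val x X X ≠ 0 →
        S.g.sectionalCurvature x X (S.ξ x) = κ + μ * (S.g.val x (S.h x X) X / S.g.val x X X) ∧
        (X ∈ S.D lam x → S.g.sectionalCurvature x X (S.ξ x) = κ + lam * μ) ∧
        (X ∈ S.D (-lam) x → S.g.sectionalCurvature x X (S.ξ x) = κ - lam * μ)) ∧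
    (∀ X ∈ S.D lam x, ∀ Y ∈ S.D lam x, S.g.IsNondegeneratePlane x X Y →
      S.g.sectionalCurvature x X Y = 2 * (S.ε + lam) - S.ε * μ) ∧
    (∀ X ∈ S.D lam x, ∀ Y ∈ S.D (-lam) x, S.g.val x X X ≠ 0 → S.g.val x Y Y ≠ 0 →
      S.g.sectionalCurvature x X Y =
        -(κ + S.ε * μ) * (S.g.val x X (S.φ x Y) ^ 2 / (S.g.val x X X * S.g.val x Y Y))) ∧
    (∀ X ∈ S.D (-lam) x, ∀ Y ∈ S.D (-lam) x, S.g.IsNondegeneratePlane x X Y →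
      S.g.sectionalCurvature x X Y = 2 * (S.ε - lam) - S.ε * μ) ∧
    (∀ X : TangentSpace (𝓡 (2 * n + 1)) x,
      S.g.ricciOperator x X =
        (S.ε * (2 * ((n : ℝ) - 1) - n * μ)) • X + (2 * ((n : ℝ) - 1) + μ) • S.h x X
          + ((2 * (1 - (n : ℝ)) * S.ε + 2 * n * κ + n * S.ε * μ) * S.η x X) • S.ξ x) := by
  have hn : Module.finrank ℝ (EuclideanSpace ℝ (Fin (2 * n + 1))) = 2 * n + 1 := by simp
  have hpos : 0 < 1 - S.ε * κ := sub_pos.2 hκ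
  -- Strict positivity of 1 - εκ makes λ nonzero; the statements about -λ follow from the same
  -- lemmas through `hc.neg`.
  have hc : (hS.tensor x hκ).IsEigenvalue lam := by
    rw [hlam]
    exact ⟨(Real.sqrt_pos.2 hpos).ne', Real.mul_self_sqrt hpos.le⟩
  refine ⟨fun X hX hX0 ↦ ⟨hS.sectionalCurvature_ξ x hX hX0, fun hD ↦ ?_, fun hD ↦ ?_⟩,
    fun X hX Y hY hXY ↦ hS.sectionalCurvature_eigen x hκ hc hX hY hXY,
    fun X hX Y hY _ _ ↦ hS.sectionalCurvature_eigen_neg x hκ hc hX hY,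
    fun X hX Y hY hXY ↦ ?_, fun X ↦ hS.ricciOperator_eq x hκ hn hc X⟩
  · have h : S.h x X = lam • X := hD
    rw [hS.sectionalCurvature_ξ x hX hX0, h, map_smul, smul_apply, smul_eq_mul,
      mul_div_cancel_right₀ _ hX0, mul_comm]
  · have h : S.h x X = (-lam) • X := hD
    rw [hS.sectionalCurvature_ξ x hX hX0, h, map_smul, smul_apply, smul_eq_mul,
      mul_div_cancel_right₀ _ hX0]
    ring
  · rw [hS.sectionalCurvature_eigen x hκ hc.neg hX hY hXY]; ring
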